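/- Let $M$ be a compact connected complex manifold of dimension $m$ that admits a smooth Hermitian metric $h$ with positive holomorphic sectional curvature, i.e. the Chern curvature $$R_{\mu\bar\nu\gamma\bar\delta}=-\frac{\partial^2 h_{\gamma\bar\delta}}{\partial z^\mu\partial\bar z^\nu}+h^{\alpha\bar\beta}\frac{\partial h_{\gamma\bar\beta}}{\partial z^\mu}\frac{\partial h_{\alpha\bar\delta}}{\partial\bar z^\nu}$$ satisfies $R_{\mu\bar\nu\gamma\bar\delta}W^\mu\bar W^\nu W^\gamma\bar W^\delta>0$ at every point and for every nonzero tangent vector $W$ (indices refer to local holomorphic coordinates $z^\alpha$; repeated indices are summed). (a) Let $(N,g)$ be a Riemannian manifold with non-positive Riemannian sectional curvature, and let $f:M\to N$ be a smooth map that is pluri-harmonic, i.e. in local holomorphic coordinates $z^\alpha$ on $M$ and local coordinates $x^i$ on $N$, $$\frac{\partial^2 f^i}{\partial z^\alpha\partial\bar z^\beta}+\Gamma^i_{jk}\frac{\partial f^j}{\partial\bar z^\beta}\frac{\partial f^k}{\partial z^\alpha}=0\quad\text{for all } i,\alpha,\beta,$$ where $\Gamma^i_{jk}$ are the Christoffel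 symbols of the Levi-Civita connection of $g$. Then $f$ is constant. (b) Let $(N,g)$ be a Kähler manifold whose background Riemannian metric has non-positive Riemannian sectional curvature, and let $f:M\to N$ be a smooth map that is pluri-harmonic, i.e. in local holomorphic coordinates $z^\alpha$ on $M$ and $w^i$ on $N$, $$\frac{\partial^2 f^i}{\partial z^\alpha\partial\bar z^\beta}+\Gamma^i_{jk}\frac{\partial f^j}{\partial z^\alpha}\frac{\partial f^k}{\partial\bar z^\beta}=0\quad\text{for all } i,\alpha,\beta,$$ where $\Gamma^i_{jk}=g^{i\bar\ell}\,\partial g_{k\bar\ell}/\partial w^j$ are the Christoffel symbols of the Chern connection of $g$. Then $f$ is constant. -/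

import Mathlib

open scoped Manifold ContDiff
open Bundle

noncomputable section

/-! ### Riemannian geometry in local coordinates

`F` is the coordinate space, `b i` is the `i`-th coordinate vector (so that `∂/∂xⁱ` is the
derivative in the direction `b i`), and `G y` is the matrix `g_{ij}` of the metric at the
coordinate point `y`. -/

section LocalRiemannian

variable {F : Type*} [NormedAddCommGroup F] [NormedSpace ℝ F]
  {ι : Type*} [Fintype ι] [DecidableEq ι]

/-- The partial derivative `∂φ/∂xⁱ` at `y`. -/
def coordDeriv (b : ι → F) (i : ι) (φ : F → ℝ) (y : F) : ℝ :=
  fderiv ℝ φ y (b i)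

/-- The Christoffel symbol `Γⁱ_{jk}` of the Levi-Civita connection,
`Γⁱ_{jk} = ½ gⁱˡ (∂_j g_{kl} + ∂_k g_{jl} - ∂_l g_{jk})`. -/
def christoffel (b : ι → F) (G : F → Matrix ι ι ℝ) (i j k : ι) (y : F) : ℝ :=
  (1 / 2) * ∑ l, (G y)⁻¹ i l *
    (coordDeriv b j (fun x => G x k l) y + coordDeriv b k (fun x => G x j l) y
      - coordDeriv b l (fun x => G x j k) y)

/-- The components `R_{ijk}^s` of `R(X,Y)Z = ∇_X ∇_Y Z - ∇_Y ∇_X Z - ∇_{[X,Y]} Z`, that is,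
`R(∂_i, ∂_j) ∂_k = R_{ijk}^s ∂_s`. -/
def riemannUp (b : ι → F) (G : F → Matrix ι ι ℝ) (i j k s : ι) (y : F) : ℝ :=
  coordDeriv b i (christoffel b G s k j) y - coordDeriv b j (christoffel b G s k i) y
    + ∑ p, (christoffel b G p k j y * christoffel b G s p i y
      - christoffel b G p k i y * christoffel b G s p j y)

/-- `R_{ijkl} = g_{sl} R_{ijk}^s`, that is, `R_{ijkl} = g(R(∂_i, ∂_j) ∂_k, ∂_l)`. -/
def riemannDown (b : ι → F) (G : F → Matrix ι ι ℝ) (i j k l : ι) (y : F) : ℝ :=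
  ∑ s, G y s l * riemannUp b G i j k s y

/-- The inner product of the tangent vectors with components `u` and `v`. -/
def metricForm (G : F → Matrix ι ι ℝ) (y : F) (u v : ι → ℝ) : ℝ :=
  ∑ i, ∑ j, G y i j * u i * v j

/-- The sectional curvature `R(u,v,v,u) / (|u|² |v|² - ⟨u,v⟩²)` of the plane spanned by the
tangent vectors with components `u` and `v`. -/
def sectionalCurvature (b : ι → F) (G : F → Matrix ι ι ℝ) (y : F) (u v : ι → ℝ) : ℝ :=
  (∑ i, ∑ j, ∑ k, ∑ l, riemannDown b G i j k l y * u i * v j * v k * u l) /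
    (metricForm G y u u * metricForm G y v v - metricForm G y u v ^ 2)

end LocalRiemannian

/-! ### Wirtinger derivatives on `ℂᵐ` -/

/-- `∂φ/∂z^α = ½ (∂φ/∂x^α - i ∂φ/∂y^α)`. -/
def wirtinger {m : ℕ} (α : Fin m) (φ : EuclideanSpace ℂ (Fin m) → ℂ)
    (z : EuclideanSpace ℂ (Fin m)) : ℂ :=
  (1 / 2) * (fderiv ℝ φ z (EuclideanSpace.single α 1)
    - Complex.I * fderiv ℝ φ z (EuclideanSpace.single α Complex.I))

/-- `∂φ/∂z̄^α = ½ (∂φ/∂x^α + i ∂φ/∂y^α)`. -/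
def wirtingerBar {m : ℕ} (α : Fin m) (φ : EuclideanSpace ℂ (Fin m) → ℂ)
    (z : EuclideanSpace ℂ (Fin m)) : ℂ :=
  (1 / 2) * (fderiv ℝ φ z (EuclideanSpace.single α 1)
    + Complex.I * fderiv ℝ φ z (EuclideanSpace.single α Complex.I))

/-! ### Hermitian metrics on complex manifolds -/

section Hermitian

variable {m : ℕ} {M : Type*} [TopologicalSpace M] [ChartedSpace (EuclideanSpace ℂ (Fin m)) M]

/-- The holomorphic charts of a complex manifold of dimension `m`. -/
abbrev holoCharts (m : ℕ) (M : Type*) [TopologicalSpace M]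
    [ChartedSpace (EuclideanSpace ℂ (Fin m)) M] :
    Set (OpenPartialHomeomorph M (EuclideanSpace ℂ (Fin m))) :=
  IsManifold.maximalAtlas 𝓘(ℂ, EuclideanSpace ℂ (Fin m)) ω M

/-- The tangent vector at the point with coordinates `z` whose representative in the
holomorphic chart `e` is `w`. -/
def holoVec (e : OpenPartialHomeomorph M (EuclideanSpace ℂ (Fin m)))
    (z w : EuclideanSpace ℂ (Fin m)) :
    TangentSpace 𝓘(ℂ, EuclideanSpace ℂ (Fin m)) (e.symm z) :=
  mfderiv 𝓘(ℂ, EuclideanSpace ℂ (Fin m)) 𝓘(ℂ, EuclideanSpace ℂ (Fin m)) e.symm z w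

/-- A (smooth) Hermitian metric on a complex manifold: a positive definite Hermitian form
on each tangent space, linear in the first and conjugate-linear in the second argument, whose
components `h_{αβ̄} = h(∂/∂z^α, ∂/∂z^β)` in holomorphic charts are smooth (in the real sense). -/
structure HermitianMetric (m : ℕ) (M : Type*) [TopologicalSpace M]
    [ChartedSpace (EuclideanSpace ℂ (Fin m)) M] where
  inner (x : M) : TangentSpace 𝓘(ℂ, EuclideanSpace ℂ (Fin m)) x →ₗ[ℂ]
    TangentSpace 𝓘(ℂ, EuclideanSpace ℂ (Fin m)) x →ₗ⋆[ℂ] ℂ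
  conj_symm (x : M) (u v : TangentSpace 𝓘(ℂ, EuclideanSpace ℂ (Fin m)) x) :
    star (inner x v u) = inner x u v
  pos (x : M) (u : TangentSpace 𝓘(ℂ, EuclideanSpace ℂ (Fin m)) x) (hu : u ≠ 0) :
    0 < (inner x u u).re
  smooth (e : OpenPartialHomeomorph M (EuclideanSpace ℂ (Fin m))) (he : e ∈ holoCharts m M)
    (α β : Fin m) :
    ContDiffOn ℝ ∞ (fun z => inner (e.symm z) (holoVec e z (EuclideanSpace.single α 1))
      (holoVec e z (EuclideanSpace.single β 1))) e.target

namespace HermitianMetric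

/-- The matrix `h_{αβ̄}` (row `α`, column `β`) of the metric in a holomorphic chart. -/
def coeff (h : HermitianMetric m M) (e : OpenPartialHomeomorph M (EuclideanSpace ℂ (Fin m)))
    (z : EuclideanSpace ℂ (Fin m)) : Matrix (Fin m) (Fin m) ℂ :=
  Matrix.of fun α β => h.inner (e.symm z) (holoVec e z (EuclideanSpace.single α 1))
    (holoVec e z (EuclideanSpace.single β 1))

/-- The inverse metric `h^{αβ̄}`, normalized by `∑_β h^{αβ̄} h_{γβ̄} = δ^α_γ`. -/
def coeffInv (h : HermitianMetric m M) (e : OpenPartialHomeomorph M (EuclideanSpace ℂ (Fin m)))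
    (α β : Fin m) (z : EuclideanSpace ℂ (Fin m)) : ℂ :=
  (h.coeff e z)⁻¹ β α

/-- The Chern curvature
`R_{μν̄γδ̄} = -∂²h_{γδ̄}/∂z^μ∂z̄^ν + h^{αβ̄} (∂h_{γβ̄}/∂z^μ) (∂h_{αδ̄}/∂z̄^ν)`. -/
def chernCurvature (h : HermitianMetric m M)
    (e : OpenPartialHomeomorph M (EuclideanSpace ℂ (Fin m))) (μ ν γ δ : Fin m)
    (z : EuclideanSpace ℂ (Fin m)) : ℂ :=
  -wirtinger μ (wirtingerBar ν (fun w => h.coeff e w γ δ)) z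
    + ∑ α, ∑ β, h.coeffInv e α β z * wirtinger μ (fun w => h.coeff e w γ β) z
      * wirtingerBar ν (fun w => h.coeff e w α δ) z

/-- The holomorphic sectional curvature `R(W,W̄,W,W̄) / |W|⁴` in the direction of the
tangent vector with components `W` (the numerator is automatically real). -/
def holoSectionalCurvature (h : HermitianMetric m M)
    (e : OpenPartialHomeomorph M (EuclideanSpace ℂ (Fin m)))
    (z : EuclideanSpace ℂ (Fin m)) (W : Fin m → ℂ) : ℝ :=
  (∑ μ, ∑ ν, ∑ γ, ∑ δ,
      h.chernCurvature e μ ν γ δ z * W μ * star (W ν) * W γ * star (W δ)).re /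
    (∑ α, ∑ β, h.coeff e z α β * W α * star (W β)).re ^ 2

/-- Positive holomorphic sectional curvature, at every point and in every direction. -/
def HasPositiveHSC (h : HermitianMetric m M) : Prop :=
  ∀ e ∈ holoCharts m M, ∀ z ∈ e.target, ∀ W : Fin m → ℂ, W ≠ 0 →
    0 < h.holoSectionalCurvature e z W

/-- The Kähler condition `dω_h = 0`: in holomorphic charts `∂h_{ij̄}/∂w^k = ∂h_{kj̄}/∂w^i`. -/
def IsKahler (h : HermitianMetric m M) : Prop :=
  ∀ e ∈ holoCharts m M, ∀ z ∈ e.target, ∀ i j k : Fin m,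
    wirtinger k (fun w => h.coeff e w i j) z = wirtinger i (fun w => h.coeff e w k j) z

/-- The coordinate vectors of the real coordinates `(Re w¹, …, Re wᵐ, Im w¹, …, Im wᵐ)`. -/
def realFrame (m : ℕ) : Fin m ⊕ Fin m → EuclideanSpace ℂ (Fin m) :=
  Sum.elim (fun j => EuclideanSpace.single j 1) (fun j => EuclideanSpace.single j Complex.I)

/-- The matrix of the background Riemannian metric `Re h` in the real coordinates underlying
a holomorphic chart. -/
def realCoeff (h : HermitianMetric m M)
    (e : OpenPartialHomeomorph M (EuclideanSpace ℂ (Fin m)))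
    (z : EuclideanSpace ℂ (Fin m)) : Matrix (Fin m ⊕ Fin m) (Fin m ⊕ Fin m) ℝ :=
  Matrix.of fun i j =>
    (h.inner (e.symm z) (holoVec e z (realFrame m i)) (holoVec e z (realFrame m j))).re

/-- Non-positive Riemannian sectional curvature of the background Riemannian metric. -/
def HasNonposSectionalCurvature (h : HermitianMetric m M) : Prop :=
  ∀ e ∈ holoCharts m M, ∀ z ∈ e.target, ∀ u v : Fin m ⊕ Fin m → ℝ,
    LinearIndependent ℝ ![u, v] →
      sectionalCurvature (realFrame m) (h.realCoeff e) z u v ≤ 0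

/-- The Christoffel symbol `Γⁱ_{jk} = g^{il̄} ∂g_{kl̄}/∂w^j` of the Chern connection. -/
def chernChristoffel (h : HermitianMetric m M)
    (e : OpenPartialHomeomorph M (EuclideanSpace ℂ (Fin m))) (i j k : Fin m)
    (z : EuclideanSpace ℂ (Fin m)) : ℂ :=
  ∑ l, h.coeffInv e i l z * wirtinger j (fun w => h.coeff e w k l) z

end HermitianMetric

end Hermitian

/-! ### Riemannian manifolds -/

section Riemannian

variable {n : ℕ} {N : Type*} [TopologicalSpace N] [ChartedSpace (EuclideanSpace ℝ (Fin n)) N]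

/-- The smooth charts of a smooth manifold of dimension `n`. -/
abbrev smoothCharts (n : ℕ) (N : Type*) [TopologicalSpace N]
    [ChartedSpace (EuclideanSpace ℝ (Fin n)) N] :
    Set (OpenPartialHomeomorph N (EuclideanSpace ℝ (Fin n))) :=
  IsManifold.maximalAtlas 𝓘(ℝ, EuclideanSpace ℝ (Fin n)) ∞ N

/-- Smooth Riemannian metrics on a smooth manifold of dimension `n`. -/
abbrev SmoothRiemannianMetric (n : ℕ) (N : Type*) [TopologicalSpace N]
    [ChartedSpace (EuclideanSpace ℝ (Fin n)) N]
    [IsManifold 𝓘(ℝ, EuclideanSpace ℝ (Fin n)) ∞ N] : Type _ :=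
  ContMDiffRiemannianMetric 𝓘(ℝ, EuclideanSpace ℝ (Fin n)) ∞ (EuclideanSpace ℝ (Fin n))
    (fun x : N => TangentSpace 𝓘(ℝ, EuclideanSpace ℝ (Fin n)) x)

/-- The coordinate vectors of `ℝⁿ`. -/
def stdFrame (n : ℕ) (i : Fin n) : EuclideanSpace ℝ (Fin n) :=
  EuclideanSpace.single i 1

/-- The coordinate vector field `∂/∂xⁱ` of the chart `e` at the point with coordinates `y`. -/
def chartVec (e : OpenPartialHomeomorph N (EuclideanSpace ℝ (Fin n)))
    (y : EuclideanSpace ℝ (Fin n)) (i : Fin n) :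
    TangentSpace 𝓘(ℝ, EuclideanSpace ℝ (Fin n)) (e.symm y) :=
  mfderiv 𝓘(ℝ, EuclideanSpace ℝ (Fin n)) 𝓘(ℝ, EuclideanSpace ℝ (Fin n)) e.symm y (stdFrame n i)

variable [IsManifold 𝓘(ℝ, EuclideanSpace ℝ (Fin n)) ∞ N]

/-- The matrix `g_{ij} = g(∂/∂xⁱ, ∂/∂xʲ)` of the metric in a chart. -/
def metricCoeff (g : SmoothRiemannianMetric n N)
    (e : OpenPartialHomeomorph N (EuclideanSpace ℝ (Fin n)))
    (y : EuclideanSpace ℝ (Fin n)) : Matrix (Fin n) (Fin n) ℝ :=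
  Matrix.of fun i j => g.inner (e.symm y) (chartVec e y i) (chartVec e y j)

/-- Non-positive Riemannian sectional curvature. -/
def HasNonposSectionalCurvature (g : SmoothRiemannianMetric n N) : Prop :=
  ∀ e ∈ smoothCharts n N, ∀ y ∈ e.target, ∀ u v : Fin n → ℝ, LinearIndependent ℝ ![u, v] →
    sectionalCurvature (stdFrame n) (metricCoeff g e) y u v ≤ 0

end Riemannian

/-! ### Pluri-harmonic maps -/

section PluriHarmonic

variable {m : ℕ} {M : Type*} [TopologicalSpace M] [ChartedSpace (EuclideanSpace ℂ (Fin m)) M]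
  {n : ℕ} {N : Type*} [TopologicalSpace N]

/-- A smooth map from a complex manifold to a Riemannian manifold is pluri-harmonic if, in
holomorphic charts of the source and smooth charts of the target, with `Γ` the Christoffel
symbols of the Levi-Civita connection,
`∂²fⁱ/∂z^α∂z̄^β + Γⁱ_{jk} (∂fʲ/∂z̄^β) (∂fᵏ/∂z^α) = 0` for all `i`, `α`, `β`. -/
def IsPluriHarmonic [ChartedSpace (EuclideanSpace ℝ (Fin n)) N]
    [IsManifold 𝓘(ℝ, EuclideanSpace ℝ (Fin n)) ∞ N]
    (g : SmoothRiemannianMetric n N) (f : M → N) : Prop :=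
  ContMDiff 𝓘(ℝ, EuclideanSpace ℂ (Fin m)) 𝓘(ℝ, EuclideanSpace ℝ (Fin n)) ∞ f ∧
  ∀ φ ∈ holoCharts m M, ∀ ψ ∈ smoothCharts n N, ∀ z ∈ φ.target, f (φ.symm z) ∈ ψ.source →
    ∀ (i : Fin n) (α β : Fin m),
      wirtinger α (wirtingerBar β (fun w => ((ψ (f (φ.symm w)) i : ℝ) : ℂ))) z
        + ∑ j, ∑ k, ((christoffel (stdFrame n) (metricCoeff g ψ) i j k (ψ (f (φ.symm z))) : ℝ) : ℂ)
          * wirtingerBar β (fun w => ((ψ (f (φ.symm w)) j : ℝ) : ℂ)) z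
          * wirtinger α (fun w => ((ψ (f (φ.symm w)) k : ℝ) : ℂ)) z = 0

/-- A smooth map from a complex manifold to a Hermitian manifold is pluri-harmonic if, in
holomorphic charts of source and target, with `Γ` the Christoffel symbols of the Chern
connection, `∂²fⁱ/∂z^α∂z̄^β + Γⁱ_{jk} (∂fʲ/∂z^α) (∂fᵏ/∂z̄^β) = 0` for all `i`, `α`, `β`. -/
def IsHermitianPluriHarmonic [ChartedSpace (EuclideanSpace ℂ (Fin n)) N]
    (g : HermitianMetric n N) (f : M → N) : Prop :=
  ContMDiff 𝓘(ℝ, EuclideanSpace ℂ (Fin m)) 𝓘(ℝ, EuclideanSpace ℂ (Fin n)) ∞ f ∧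
  ∀ φ ∈ holoCharts m M, ∀ ψ ∈ holoCharts n N, ∀ z ∈ φ.target, f (φ.symm z) ∈ ψ.source →
    ∀ (i : Fin n) (α β : Fin m),
      wirtinger α (wirtingerBar β (fun w => ψ (f (φ.symm w)) i)) z
        + ∑ j, ∑ k, g.chernChristoffel ψ i j k (ψ (f (φ.symm z)))
          * wirtinger α (fun w => ψ (f (φ.symm w)) j) z
          * wirtingerBar β (fun w => ψ (f (φ.symm w)) k) z = 0

end PluriHarmonic

end

/-! For a nonzero tangent vector W at x put Q(x, W) = (|df(W)|² + |df(iW)|²) / |W|²_h. This is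
homogeneous of degree zero in W, so compactness of M yields a pair (x, W) at which Q is maximal. The
claim is that the maximum cannot be positive; then df = 0, and f is constant by connectedness.

Suppose the maximal value Q is positive. Through x runs a holomorphic disc c(t) = z + tW + (t²/2)V
in a chart. Put e(t) = |df(c')|² + |df(ic')|² and H(t) = |c'|²_h. Maximality gives e ≤ Q H near 0
with equality at 0, hence Δe(0) ≤ Q ΔH(0). Two computations contradict this.

On the target side, a pluri-harmonic map restricts to a harmonic map u = f ∘ c on a plane domain,
and e is the energy density of u. The Bochner formula expresses Δe through squares and the terms
-⟨R(u_x, u_y)u_y, u_x⟩, so Δe ≥ 0 when the sectional curvature is non-positive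
(`energy_laplacian_nonneg`).

On the source side, V can be chosen so that the covariant acceleration of the disc for the Chern
connection vanishes at x. Then ΔH(0) = -4 R(W, W̄, W, W̄) < 0
(`HermitianMetric.exists_disc_laplacian`). Together 0 ≤ Δe(0) ≤ Q ΔH(0) < 0, which is absurd
(`dirEnergy_nonpos_of_maximizer`).

The argument needs from the target only a metric of non-positive curvature with its Levi-Civita
connection in each chart (`IsNonposCoordMetric`). A Kähler target fits because its Chern connection
is torsion-free and metric, hence is the Levi-Civita connection of the real part of the metric
(`HermitianMetric.christoffelMap_realCoeff`). -/

/-! ### Covariant derivatives along maps into a coordinate domain -/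

section CovariantDerivative

variable {E : Type*} [NormedAddCommGroup E] [NormedSpace ℝ E]
  {F : Type*} [NormedAddCommGroup F] [NormedSpace ℝ F]

/-- The curvature `R(u,v)w` of the connection with Christoffel map `Γ`. -/
noncomputable def curvatureOf (Γ : F → F →L[ℝ] F →L[ℝ] F) (y u v w : F) : F :=
  fderiv ℝ Γ y u v w - fderiv ℝ Γ y v u w + Γ y u (Γ y v w) - Γ y v (Γ y u w)

/-- The covariant derivative in the direction `a` of a vector field `X` along `u`. -/
noncomputable def covDerivAlong (Γ : F → F →L[ℝ] F →L[ℝ] F) (u : E → F) (a : E) (X : E → F) (t : E) : F :=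
  fderiv ℝ X t a + Γ (u t) (fderiv ℝ u t a) (X t)

variable {Γ : F → F →L[ℝ] F →L[ℝ] F} {u : E → F}

theorem covDerivAlong_congr {a : E} {X Y : E → F} {t : E} (h : X =ᶠ[nhds t] Y) :
    covDerivAlong Γ u a X t = covDerivAlong Γ u a Y t := by
  simp [covDerivAlong, h.fderiv_eq, h.eq_of_nhds]

theorem covDerivAlong_neg (a : E) (X : E → F) (t : E) :
    covDerivAlong Γ u a (fun s => -X s) t = -covDerivAlong Γ u a X t := by
  simp only [covDerivAlong, fderiv_fun_neg]
  simp
  abel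

theorem HasFDerivAt.bilin_apply {G : Type*} [NormedAddCommGroup G] [NormedSpace ℝ G]
    {A : E → F →L[ℝ] F →L[ℝ] G} {A' : E →L[ℝ] F →L[ℝ] F →L[ℝ] G} {X Y : E → F}
    {X' Y' : E →L[ℝ] F} {t : E} (hA : HasFDerivAt A A' t) (hX : HasFDerivAt X X' t)
    (hY : HasFDerivAt Y Y' t) :
    DifferentiableAt ℝ (fun s => A s (X s) (Y s)) t ∧ ∀ a,
      fderiv ℝ (fun s => A s (X s) (Y s)) t a
        = A' a (X t) (Y t) + A t (X' a) (Y t) + A t (X t) (Y' a) := by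
  have h1 : HasFDerivAt (fun s => A s (X s)) _ t := HasFDerivAt.clm_apply hA hX
  have h2 : HasFDerivAt (fun s => A s (X s) (Y s)) _ t := HasFDerivAt.clm_apply h1 hY
  refine ⟨h2.differentiableAt, fun a => ?_⟩
  rw [h2.fderiv]
  simp
  abel

theorem fderiv_metric_along {g : F → F →L[ℝ] F →L[ℝ] ℝ} {X Y : E → F} {t : E} (a : E)
    (hg : DifferentiableAt ℝ g (u t)) (hu : DifferentiableAt ℝ u t)
    (hX : DifferentiableAt ℝ X t) (hY : DifferentiableAt ℝ Y t)
    (hc : ∀ w v v', fderiv ℝ g (u t) w v v' = g (u t) (Γ (u t) w v) v' + g (u t) v (Γ (u t) w v')) :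
    fderiv ℝ (fun s => g (u s) (X s) (Y s)) t a
      = g (u t) (covDerivAlong Γ u a X t) (Y t) + g (u t) (X t) (covDerivAlong Γ u a Y t) := by
  have h1 := HasFDerivAt.comp (g := g) (f := u) t hg.hasFDerivAt hu.hasFDerivAt
  rw [(HasFDerivAt.bilin_apply (A := fun s => g (u s)) h1 hX.hasFDerivAt hY.hasFDerivAt).2]
  simp [covDerivAlong, hc]
  ring

/-- Pulled-back form of torsion-freeness: the second derivative of `u` is symmetric, and so is `Γ`.
-/
theorem covDerivAlong_symm {t : E} (a b : E) (hu : ContDiffAt ℝ 2 u t)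
    (hs : ∀ v w, Γ (u t) v w = Γ (u t) w v) :
    covDerivAlong Γ u a (fun s => fderiv ℝ u s b) t
      = covDerivAlong Γ u b (fun s => fderiv ℝ u s a) t := by
  have hd : DifferentiableAt ℝ (fderiv ℝ u) t :=
    (hu.fderiv_right (m := 1) (by norm_num)).differentiableAt (by norm_num)
  have e : ∀ a b : E, fderiv ℝ (fun s => fderiv ℝ u s b) t a = fderiv ℝ (fderiv ℝ u) t a b := by
    intro a b
    simp [(hd.hasFDerivAt.clm_apply (hasFDerivAt_const b t)).fderiv]
  have hsym := (hu.isSymmSndFDerivAt (by simp)).eq a b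
  simp only [covDerivAlong, e, hsym, hs (fderiv ℝ u t a)]

theorem hasFDerivAt_covDerivAlong {X : E → F} {t : E} (b : E) (hΓ : DifferentiableAt ℝ Γ (u t))
    (hu : ContDiffAt ℝ 2 u t) (hX : ContDiffAt ℝ 2 X t) (a : E) :
    DifferentiableAt ℝ (covDerivAlong Γ u b X) t ∧
    fderiv ℝ (covDerivAlong Γ u b X) t a
      = fderiv ℝ (fderiv ℝ X) t a b + (fderiv ℝ Γ (u t) (fderiv ℝ u t a) (fderiv ℝ u t b) (X t)
        + Γ (u t) (fderiv ℝ (fderiv ℝ u) t a b) (X t)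
        + Γ (u t) (fderiv ℝ u t b) (fderiv ℝ X t a)) := by
  have hdu : DifferentiableAt ℝ (fderiv ℝ u) t :=
    (hu.fderiv_right (m := 1) (by norm_num)).differentiableAt (by norm_num)
  have hdX : DifferentiableAt ℝ (fderiv ℝ X) t :=
    (hX.fderiv_right (m := 1) (by norm_num)).differentiableAt (by norm_num)
  have hu1 := (hu.differentiableAt (by norm_num)).hasFDerivAt
  have hX1 := (hX.differentiableAt (by norm_num)).hasFDerivAt
  have h1 := HasFDerivAt.comp (g := Γ) (f := u) t hΓ.hasFDerivAt hu1
  have h2 : HasFDerivAt (fun s => fderiv ℝ u s b) _ t :=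
    hdu.hasFDerivAt.clm_apply (hasFDerivAt_const b t)
  have h3 : HasFDerivAt (fun s => fderiv ℝ X s b) _ t :=
    hdX.hasFDerivAt.clm_apply (hasFDerivAt_const b t)
  have h4 := HasFDerivAt.bilin_apply h1 h2 hX1
  refine ⟨h3.differentiableAt.add h4.1, ?_⟩
  have h5 : fderiv ℝ (covDerivAlong Γ u b X) t = _ :=
    (h3.add h4.1.hasFDerivAt).fderiv
  rw [h5, add_apply, h4.2]
  simp

/-- Covariant derivatives along `u` commute up to curvature. The directions `a` and `b` are
constant, so there is no bracket term, and the second derivatives of `u` and of `X` cancel by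
symmetry. -/
theorem covDerivAlong_comm {X : E → F} {t : E} (a b : E) (hΓ : DifferentiableAt ℝ Γ (u t))
    (hu : ContDiffAt ℝ 2 u t) (hX : ContDiffAt ℝ 2 X t) :
    covDerivAlong Γ u a (covDerivAlong Γ u b X) t
      = covDerivAlong Γ u b (covDerivAlong Γ u a X) t
        + curvatureOf Γ (u t) (fderiv ℝ u t a) (fderiv ℝ u t b) (X t) := by
  have e : ∀ a b, covDerivAlong Γ u a (covDerivAlong Γ u b X) t
      = fderiv ℝ (covDerivAlong Γ u b X) t a
        + Γ (u t) (fderiv ℝ u t a) (covDerivAlong Γ u b X t) := fun _ _ => rfl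
  rw [e, e, (hasFDerivAt_covDerivAlong b hΓ hu hX a).2,
    (hasFDerivAt_covDerivAlong a hΓ hu hX b).2, (hu.isSymmSndFDerivAt (by simp)).eq a b,
    (hX.isSymmSndFDerivAt (by simp)).eq a b]
  simp only [covDerivAlong, curvatureOf, map_add]
  abel

/-- The second directional derivative. -/
noncomputable def secondDirDeriv {G : Type*} [NormedAddCommGroup G] [NormedSpace ℝ G]
    (Φ : E → G) (a t : E) : G :=
  fderiv ℝ (fun s => fderiv ℝ Φ s a) t a

theorem secondDirDeriv_metric_along {g : F → F →L[ℝ] F →L[ℝ] ℝ} {X : E → F} {t : E}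
    {U : Set E} {T : Set F} (hU : IsOpen U) (hT : IsOpen T) (ht : t ∈ U)
    (hg : ContDiffOn ℝ ∞ g T) (hΓ : ContDiffOn ℝ ∞ Γ T) (hu : ContDiffOn ℝ ∞ u U)
    (hX : ContDiffOn ℝ ∞ X U) (hUT : Set.MapsTo u U T)
    (hsymm : ∀ y ∈ T, ∀ v w, g y v w = g y w v)
    (hc : ∀ y ∈ T, ∀ w v v', fderiv ℝ g y w v v' = g y (Γ y w v) v' + g y v (Γ y w v')) (a : E) :
    secondDirDeriv (fun s => g (u s) (X s) (X s)) a t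
      = 2 * (g (u t) (covDerivAlong Γ u a (covDerivAlong Γ u a X) t) (X t)
        + g (u t) (covDerivAlong Γ u a X t) (covDerivAlong Γ u a X t)) := by
  have two : ∀ {G : Type _} [NormedAddCommGroup G] [NormedSpace ℝ G] {f : E → G},
      ContDiffOn ℝ ∞ f U → ∀ s ∈ U, ContDiffAt ℝ 2 f s := fun h s hs =>
    (h.contDiffAt (hU.mem_nhds hs)).of_le (by norm_cast)
  have gd : ∀ s ∈ U, DifferentiableAt ℝ g (u s) := fun s hs =>
    (hg.contDiffAt (hT.mem_nhds (hUT hs))).differentiableAt (by simp)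
  have Γd : ∀ s ∈ U, DifferentiableAt ℝ Γ (u s) := fun s hs =>
    (hΓ.contDiffAt (hT.mem_nhds (hUT hs))).differentiableAt (by simp)
  have ud : ∀ s ∈ U, DifferentiableAt ℝ u s := fun s hs =>
    (two hu s hs).differentiableAt (by simp)
  have Xd : ∀ s ∈ U, DifferentiableAt ℝ X s := fun s hs =>
    (two hX s hs).differentiableAt (by simp)
  -- The first-derivative formula is about to be differentiated again, so it is needed on a
  -- neighbourhood of `t` and not only at `t`.
  have e1 : (fun s => fderiv ℝ (fun s => g (u s) (X s) (X s)) s a) =ᶠ[nhds t]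
      fun s => (2 : ℝ) • g (u s) (covDerivAlong Γ u a X s) (X s) := by
    filter_upwards [hU.mem_nhds ht] with s hs
    rw [fderiv_metric_along a (gd s hs) (ud s hs) (Xd s hs) (Xd s hs) (hc _ (hUT hs)),
      hsymm _ (hUT hs) (X s), smul_eq_mul]
    ring
  have hd := (hasFDerivAt_covDerivAlong a (Γd t ht) (two hu t ht) (two hX t ht) a).1
  have h1 := HasFDerivAt.comp (g := g) (f := u) t (gd t ht).hasFDerivAt (ud t ht).hasFDerivAt
  have hd2 := (HasFDerivAt.bilin_apply (A := fun s => g (u s)) h1 hd.hasFDerivAt (Xd t ht).hasFDerivAt).1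
  rw [secondDirDeriv, e1.fderiv_eq, fderiv_fun_const_smul hd2, smul_apply,
    fderiv_metric_along a (gd t ht) (ud t ht) hd (Xd t ht) (hc _ (hUT ht)), smul_eq_mul]

end CovariantDerivative

/-! ### The Bochner inequality and the second-order test at a maximum -/

/-- Bochner inequality: the energy density of a harmonic map from a plane domain to a coordinate
domain with non-positive sectional curvature is subharmonic. -/
theorem energy_laplacian_nonneg {F : Type*} [NormedAddCommGroup F] [NormedSpace ℝ F]
    {g : F → F →L[ℝ] F →L[ℝ] ℝ} {Γ : F → F →L[ℝ] F →L[ℝ] F} {u : ℂ → F} {U : Set ℂ} {T : Set F}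
    (hU : IsOpen U) (hT : IsOpen T) {t : ℂ} (ht : t ∈ U)
    (hg : ContDiffOn ℝ ∞ g T) (hΓ : ContDiffOn ℝ ∞ Γ T) (hu : ContDiffOn ℝ ∞ u U)
    (hUT : Set.MapsTo u U T) (hsymm : ∀ y ∈ T, ∀ v w, g y v w = g y w v)
    (hnn : ∀ y ∈ T, ∀ v, 0 ≤ g y v v) (hΓs : ∀ y ∈ T, ∀ v w, Γ y v w = Γ y w v)
    (hc : ∀ y ∈ T, ∀ w v v', fderiv ℝ g y w v v' = g y (Γ y w v) v' + g y v (Γ y w v'))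
    (hK : ∀ y ∈ T, ∀ v w, g y (curvatureOf Γ y v w w) v ≤ 0)
    (hharm : ∀ s ∈ U, covDerivAlong Γ u 1 (fun r => fderiv ℝ u r 1) s
      + covDerivAlong Γ u Complex.I (fun r => fderiv ℝ u r Complex.I) s = 0) :
    0 ≤ (secondDirDeriv (fun s => g (u s) (fderiv ℝ u s 1) (fderiv ℝ u s 1)) 1 t
        + secondDirDeriv (fun s => g (u s) (fderiv ℝ u s 1) (fderiv ℝ u s 1)) Complex.I t)
      + (secondDirDeriv
          (fun s => g (u s) (fderiv ℝ u s Complex.I) (fderiv ℝ u s Complex.I)) 1 t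
        + secondDirDeriv
          (fun s => g (u s) (fderiv ℝ u s Complex.I) (fderiv ℝ u s Complex.I)) Complex.I t) := by
  have hX : ∀ a : ℂ, ContDiffOn ℝ ∞ (fun s => fderiv ℝ u s a) U := fun a =>
    (hu.fderiv_of_isOpen hU (m := ∞) (by simp)).clm_apply contDiffOn_const
  have two : ∀ {f : ℂ → F}, ContDiffOn ℝ ∞ f U → ∀ s ∈ U, ContDiffAt ℝ 2 f s := fun h s hs =>
    (h.contDiffAt (hU.mem_nhds hs)).of_le (by norm_cast)
  have Γd : ∀ s ∈ U, DifferentiableAt ℝ Γ (u s) := fun s hs =>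
    (hΓ.contDiffAt (hT.mem_nhds (hUT hs))).differentiableAt (by simp)
  rw [secondDirDeriv_metric_along hU hT ht hg hΓ hu (hX 1) hUT hsymm hc,
    secondDirDeriv_metric_along hU hT ht hg hΓ hu (hX 1) hUT hsymm hc,
    secondDirDeriv_metric_along hU hT ht hg hΓ hu (hX Complex.I) hUT hsymm hc,
    secondDirDeriv_metric_along hU hT ht hg hΓ hu (hX Complex.I) hUT hsymm hc]
  set X := fun s => fderiv ℝ u s 1 with hXdef
  set Y := fun s => fderiv ℝ u s Complex.I with hYdef
  have c1 : covDerivAlong Γ u 1 Y =ᶠ[nhds t] covDerivAlong Γ u Complex.I X := by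
    filter_upwards [hU.mem_nhds ht] with s hs
    exact covDerivAlong_symm _ _ (two hu s hs) (hΓs _ (hUT hs))
  have c2 : covDerivAlong Γ u 1 X =ᶠ[nhds t] fun s => -covDerivAlong Γ u Complex.I Y s := by
    filter_upwards [hU.mem_nhds ht] with s hs
    exact eq_neg_of_add_eq_zero_left (hharm s hs)
  have c3 : covDerivAlong Γ u Complex.I Y =ᶠ[nhds t] fun s => -covDerivAlong Γ u 1 X s := by
    filter_upwards [hU.mem_nhds ht] with s hs
    exact eq_neg_of_add_eq_zero_right (hharm s hs)
  -- With X = u_x and Y = u_y: D_x D_x X = -D_x D_y Y by harmonicity, which is -D_y D_x Y - R(X, Y)Y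
  -- by commutation, and D_x Y = D_y X by symmetry.
  have k1 : covDerivAlong Γ u 1 (covDerivAlong Γ u 1 X) t
      = -covDerivAlong Γ u Complex.I (covDerivAlong Γ u Complex.I X) t
        - curvatureOf Γ (u t) (X t) (Y t) (Y t) := by
    rw [covDerivAlong_congr c2, covDerivAlong_neg,
      covDerivAlong_comm _ _ (Γd t ht) (two hu t ht) (two (hX _) t ht), covDerivAlong_congr c1,
      neg_add, sub_eq_add_neg]
  have k2 : covDerivAlong Γ u Complex.I (covDerivAlong Γ u Complex.I Y) t
      = -covDerivAlong Γ u 1 (covDerivAlong Γ u 1 Y) t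
        - curvatureOf Γ (u t) (Y t) (X t) (X t) := by
    rw [covDerivAlong_congr c3, covDerivAlong_neg,
      covDerivAlong_comm _ _ (Γd t ht) (two hu t ht) (two (hX _) t ht),
      covDerivAlong_congr c1.symm, neg_add, sub_eq_add_neg]
  -- The third-order terms now cancel in pairs. What remains is four squares and two curvature
  -- terms, each of the favourable sign.
  rw [k1, k2]
  simp only [map_sub, map_neg, sub_apply, neg_apply]
  have p1 := hnn _ (hUT ht) (covDerivAlong Γ u 1 X t)
  have p2 := hnn _ (hUT ht) (covDerivAlong Γ u Complex.I X t)
  have p3 := hnn _ (hUT ht) (covDerivAlong Γ u 1 Y t)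
  have p4 := hnn _ (hUT ht) (covDerivAlong Γ u Complex.I Y t)
  have q1 := hK _ (hUT ht) (X t) (Y t)
  have q2 := hK _ (hUT ht) (Y t) (X t)
  linarith

/-- At a local maximum the second directional derivatives are non-positive. -/
theorem IsLocalMax.secondDirDeriv_nonpos {E : Type*} [NormedAddCommGroup E] [NormedSpace ℝ E]
    {Φ : E → ℝ} {t : E} (hmax : IsLocalMax Φ t) (hΦ : ContDiffAt ℝ 2 Φ t) (a : E) :
    secondDirDeriv Φ a t ≤ 0 := by
  by_contra! hpos
  set l : ℝ → E := fun x => t + x • a with hl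
  have hl0 : l 0 = t := by simp [hl]
  have hlc : Continuous l := by fun_prop
  have hld : ∀ x, HasDerivAt l a x := fun x => by
    simpa [hl] using ((hasDerivAt_id x).smul_const a).const_add t
  have hev : ∀ᶠ x in nhds (0 : ℝ), ContDiffAt ℝ 2 Φ (l x) :=
    hlc.continuousAt.eventually (hl0.symm ▸ hΦ.eventually (by simp))
  have hd1 : deriv (Φ ∘ l) =ᶠ[nhds 0] fun x => fderiv ℝ Φ (l x) a := by
    filter_upwards [hev] with x hx
    exact ((hx.differentiableAt (by norm_num)).hasFDerivAt.comp_hasDerivAt x (hld x)).deriv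
  have hfd : DifferentiableAt ℝ (fun s => fderiv ℝ Φ s a) (l 0) := by
    rw [hl0]
    exact ((hΦ.fderiv_right (m := 1) (by norm_num)).differentiableAt (by norm_num)).clm_apply
      (differentiableAt_const a)
  have hd2 : deriv (deriv (Φ ∘ l)) 0 = secondDirDeriv Φ a t := by
    rw [hd1.deriv_eq]
    have := (hfd.hasFDerivAt.comp_hasDerivAt (0 : ℝ) (hld 0)).deriv
    rw [hl0] at this
    exact this
  have hmax' : IsLocalMax (Φ ∘ l) 0 := by
    have : IsLocalMax Φ (l 0) := hl0.symm ▸ hmax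
    exact this.comp_continuous hlc.continuousAt
  -- A positive second derivative would make the maximum also a local minimum along the line. The
  -- function is then locally constant there, so its second derivative vanishes.
  have hmin := isLocalMin_of_deriv_deriv_pos (hd2 ▸ hpos) hmax'.deriv_eq_zero
    ((hl0.symm ▸ hΦ.continuousAt : ContinuousAt Φ (l 0)).comp hlc.continuousAt)
  have hconst : Φ ∘ l =ᶠ[nhds 0] fun _ => (Φ ∘ l) 0 := by
    filter_upwards [hmin, hmax'] with x h1 h2 using le_antisymm h2 h1
  have h0 : deriv (Φ ∘ l) =ᶠ[nhds 0] fun _ => 0 := by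
    filter_upwards [hconst.eventuallyEq_nhds] with x hx
    rw [hx.deriv_eq]; simp
  rw [← hd2, h0.deriv_eq] at hpos
  simp at hpos

/-! ### The Levi-Civita connection in coordinates -/

/-- A smooth positive definite metric `g` on the coordinate domain `T`, with its Levi-Civita
connection `Γ`, of non-positive sectional curvature. -/
structure IsNonposCoordMetric {F : Type*} [NormedAddCommGroup F] [NormedSpace ℝ F] (T : Set F)
    (g : F → F →L[ℝ] F →L[ℝ] ℝ) (Γ : F → F →L[ℝ] F →L[ℝ] F) : Prop where
  contDiffOn_metric : ContDiffOn ℝ ∞ g T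
  contDiffOn_christoffel : ContDiffOn ℝ ∞ Γ T
  symm : ∀ y ∈ T, ∀ v w, g y v w = g y w v
  pos : ∀ y ∈ T, ∀ v, v ≠ 0 → 0 < g y v v
  torsion_free : ∀ y ∈ T, ∀ v w, Γ y v w = Γ y w v
  compat : ∀ y ∈ T, ∀ w v v', fderiv ℝ g y w v v' = g y (Γ y w v) v' + g y v (Γ y w v')
  curvature_nonpos : ∀ y ∈ T, ∀ v w, g y (curvatureOf Γ y v w w) v ≤ 0

section Coordinates

set_option synthInstance.maxHeartbeats 200000
set_option linter.unusedSectionVars false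

variable {F : Type*} [NormedAddCommGroup F] [NormedSpace ℝ F] [FiniteDimensional ℝ F]
  {ι : Type*} [Fintype ι] [DecidableEq ι] (B : Module.Basis ι ℝ F) (G : F → Matrix ι ι ℝ)

/-- The coordinate functionals of a basis, as continuous linear maps. -/
noncomputable def coordCLM (i : ι) : F →L[ℝ] ℝ := LinearMap.toContinuousLinearMap (B.coord i)

@[simp] theorem coordCLM_apply (i : ι) (v : F) : coordCLM B i v = B.repr v i := rfl

/-- The bilinear form with coefficient matrix `G` in the basis `B`. -/
noncomputable def metricMap (y : F) : F →L[ℝ] F →L[ℝ] ℝ :=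
  ∑ i, ∑ j, G y i j • (coordCLM B i).smulRight (coordCLM B j)

/-- The Christoffel symbols assembled to a bilinear map. -/
noncomputable def christoffelMap (y : F) : F →L[ℝ] F →L[ℝ] F :=
  ∑ i, ∑ j, ∑ k, christoffel B G i k j y •
    (coordCLM B j).smulRight ((coordCLM B k).smulRight (B i))

variable {B G}

theorem metricMap_apply (y v w : F) :
    metricMap B G y v w = ∑ i, ∑ j, G y i j * B.repr v i * B.repr w j := by
  simp [metricMap, sum_apply, mul_assoc]

theorem metricMap_basis (y : F) (i j : ι) : metricMap B G y (B i) (B j) = G y i j := by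
  simp [metricMap_apply, Finsupp.single_apply]

theorem metricMap_equivFun_symm (y : F) (v w : ι → ℝ) :
    metricMap B G y (B.equivFun.symm v) (B.equivFun.symm w) = metricForm G y v w := by
  simp [metricMap_apply, metricForm, ← Module.Basis.equivFun_apply, -Module.Basis.equivFun_symm_apply]

/-- The lower indices appear in the order `k j`, as in `riemannUp`, so that the two curvature
expressions match term by term without using the symmetry of the Christoffel symbols. -/
theorem christoffelMap_basis (y : F) (j k : ι) :
    christoffelMap B G y (B j) (B k) = ∑ i, christoffel B G i k j y • B i := by
  simp [christoffelMap, sum_apply, Finsupp.single_apply, ite_smul]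

/-- Stated for a bare function with additivity and homogeneity, so that it can be applied to one
slot of a multilinear expression at a time. -/
theorem eq_sum_repr_mul {f : F → ℝ} (hadd : ∀ u v, f (u + v) = f u + f v)
    (hsmul : ∀ (c : ℝ) u, f (c • u) = c * f u) (u : F) :
    f u = ∑ i, B.repr u i * f (B i) := by
  let L : F →ₗ[ℝ] ℝ := { toFun := f, map_add' := hadd, map_smul' := by simpa using hsmul }
  have : L u = ∑ i, B.repr u i * L (B i) := by
    conv_lhs => rw [← B.sum_repr u]
    simp only [map_sum, map_smul, smul_eq_mul]
  exact this

variable {T : Set F}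

theorem ContDiffOn.smul_vec {V : Type*} [NormedAddCommGroup V] [NormedSpace ℝ V] {f : F → ℝ}
    (hf : ContDiffOn ℝ ∞ f T) (c : V) : ContDiffOn ℝ ∞ (fun y => f y • c) T :=
  hf.smul contDiffOn_const

theorem contDiffOn_metricMap (hG : ∀ i j, ContDiffOn ℝ ∞ (fun y => G y i j) T) :
    ContDiffOn ℝ ∞ (metricMap B G) T :=
  ContDiffOn.sum fun i _ => ContDiffOn.sum fun j _ => (hG i j).smul_vec _

theorem fderiv_metricMap_apply {y : F} (h : DifferentiableAt ℝ (metricMap B G) y) (a v w : F) :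
    fderiv ℝ (metricMap B G) y a v w = fderiv ℝ (fun x => metricMap B G x v w) y a := by
  rw [(HasFDerivAt.bilin_apply (A := metricMap B G) h.hasFDerivAt (hasFDerivAt_const v y)
    (hasFDerivAt_const w y)).2]
  simp

theorem contDiffOn_matrix_det {A : F → Matrix ι ι ℝ}
    (hA : ∀ i j, ContDiffOn ℝ ∞ (fun y => A y i j) T) : ContDiffOn ℝ ∞ (fun y => (A y).det) T := by
  simp only [Matrix.det_apply']
  exact ContDiffOn.sum fun σ _ => contDiffOn_const.mul (contDiffOn_prod fun i _ => hA _ _)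

/-- Cramer's rule: an entry of the inverse is a polynomial in the entries divided by the
determinant. -/
theorem contDiffOn_matrix_inv (hG : ∀ i j, ContDiffOn ℝ ∞ (fun y => G y i j) T)
    (hdet : ∀ y ∈ T, (G y).det ≠ 0) (i j : ι) : ContDiffOn ℝ ∞ (fun y => (G y)⁻¹ i j) T := by
  have h : (fun y => (G y)⁻¹ i j)
      = fun y => (G y).det⁻¹ * ((G y).updateRow j (Pi.single i 1)).det := by
    ext y
    simp [Matrix.inv_def, Ring.inverse_eq_inv', Matrix.adjugate_apply]
  rw [h]
  refine ((contDiffOn_matrix_det hG).inv hdet).mul (contDiffOn_matrix_det fun k l => ?_)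
  by_cases hk : k = j
  · subst hk; simpa using contDiffOn_const
  · simpa [Matrix.updateRow_ne hk] using hG k l

theorem contDiffOn_christoffel (hT : IsOpen T)
    (hG : ∀ i j, ContDiffOn ℝ ∞ (fun y => G y i j) T)
    (hdet : ∀ y ∈ T, (G y).det ≠ 0) (i j k : ι) : ContDiffOn ℝ ∞ (christoffel B G i j k) T := by
  have hd : ∀ i j k, ContDiffOn ℝ ∞ (fun y => coordDeriv B k (fun x => G x i j) y) T :=
    fun i j k => ((hG i j).fderiv_of_isOpen hT (m := ∞) (by simp)).clm_apply contDiffOn_const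
  exact contDiffOn_const.mul (ContDiffOn.sum fun l _ =>
    (contDiffOn_matrix_inv hG hdet i l).mul (((hd _ _ _).add (hd _ _ _)).sub (hd _ _ _)))

theorem contDiffOn_christoffelMap (hT : IsOpen T)
    (hG : ∀ i j, ContDiffOn ℝ ∞ (fun y => G y i j) T)
    (hdet : ∀ y ∈ T, (G y).det ≠ 0) : ContDiffOn ℝ ∞ (christoffelMap B G) T :=
  ContDiffOn.sum fun i _ => ContDiffOn.sum fun j _ => ContDiffOn.sum fun k _ =>
    (contDiffOn_christoffel hT hG hdet i k j).smul_vec _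

theorem sum_mul_christoffel {y : F} (hdet : (G y).det ≠ 0) (hsymm : (G y).IsSymm) (j k l : ι) :
    ∑ i, christoffel B G i j k y * G y i l
      = (1 / 2) * (coordDeriv B j (fun x => G x k l) y + coordDeriv B k (fun x => G x j l) y
        - coordDeriv B l (fun x => G x j k) y) := by
  set S : ι → ℝ := fun l => coordDeriv B j (fun x => G x k l) y
    + coordDeriv B k (fun x => G x j l) y - coordDeriv B l (fun x => G x j k) y with hS
  have h1 : G y * (G y)⁻¹ = 1 := Matrix.mul_nonsing_inv _ (isUnit_iff_ne_zero.mpr hdet)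
  have h2 : (G y).mulVec ((G y)⁻¹.mulVec S) l = S l := by
    rw [Matrix.mulVec_mulVec, h1, Matrix.one_mulVec]
  have h3 : ∀ i, christoffel B G i j k y = (1 / 2) * (G y)⁻¹.mulVec S i := fun i => rfl
  change _ = 1 / 2 * S l
  rw [← h2, Matrix.mulVec, dotProduct, Finset.mul_sum]
  refine Finset.sum_congr rfl fun i _ => ?_
  rw [h3, hsymm.apply i l]
  ring

/-- The Koszul formula. -/
theorem metricMap_christoffelMap {y : F} (hT : IsOpen T) (hy : y ∈ T)
    (hG : ∀ i j, ContDiffOn ℝ ∞ (fun y => G y i j) T)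
    (hdet : (G y).det ≠ 0) (hsymm : ∀ y ∈ T, (G y).IsSymm) (u v w : F) :
    metricMap B G y (christoffelMap B G y u v) w
      = (1 / 2) * (fderiv ℝ (metricMap B G) y u v w + fderiv ℝ (metricMap B G) y v u w
        - fderiv ℝ (metricMap B G) y w u v) := by
  have hd : DifferentiableAt ℝ (metricMap B G) y :=
    ((contDiffOn_metricMap hG).contDiffAt (hT.mem_nhds hy)).differentiableAt (by simp)
  set D := fderiv ℝ (metricMap B G) y
  -- The defect of the formula is trilinear, so it suffices that it vanishes on basis vectors, where
  -- it is the definition of the Christoffel symbols with the index lowered.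
  set P : F → F → F → ℝ := fun u v w => metricMap B G y (christoffelMap B G y u v) w
    - (1 / 2) * (D u v w + D v u w - D w u v) with hP
  suffices P u v w = 0 from sub_eq_zero.mp this
  have hb : ∀ j k l, P (B j) (B k) (B l) = 0 := by
    intro j k l
    have e : ∀ a b c, D (B a) (B b) (B c) = coordDeriv B a (fun x => G x b c) y := fun a b c => by
      simp only [D, fderiv_metricMap_apply hd, metricMap_basis, coordDeriv]
    have h := sum_mul_christoffel (B := B) hdet (hsymm y hy) k j l
    -- The reversed lower indices of `christoffelMap` produce `G x k j` in the last term. Symmetry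
    -- of `G` is known only on `T`, hence the passage through eventual equality.
    have hs : coordDeriv B l (fun x => G x k j) y = coordDeriv B l (fun x => G x j k) y := by
      have : (fun x => G x k j) =ᶠ[nhds y] fun x => G x j k := by
        filter_upwards [hT.mem_nhds hy] with x hx using (hsymm x hx).apply _ _
      rw [coordDeriv, this.fderiv_eq, coordDeriv]
    simp only [hP, christoffelMap_basis, map_sum, map_smul, sum_apply, smul_apply,
      metricMap_basis, smul_eq_mul, e, h, hs]
    ring
  rw [eq_sum_repr_mul (B := B) (f := fun u => P u v w)
    (by intros; simp [hP]; ring) (by intros; simp [hP]; ring)]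
  refine Finset.sum_eq_zero fun i _ => mul_eq_zero_of_right _ ?_
  rw [eq_sum_repr_mul (B := B) (f := fun v => P (B i) v w)
    (by intros; simp [hP]; ring) (by intros; simp [hP]; ring)]
  refine Finset.sum_eq_zero fun j _ => mul_eq_zero_of_right _ ?_
  rw [eq_sum_repr_mul (B := B) (f := fun w => P (B i) (B j) w)
    (by intros; simp [hP]; ring) (by intros; simp [hP]; ring)]
  exact Finset.sum_eq_zero fun k _ => mul_eq_zero_of_right _ (hb i j k)

theorem metricMap_curvatureOf_basis {y : F} (hT : IsOpen T) (hy : y ∈ T)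
    (hG : ∀ i j, ContDiffOn ℝ ∞ (fun y => G y i j) T)
    (hdet : ∀ y ∈ T, (G y).det ≠ 0) (i j k l : ι) :
    metricMap B G y (curvatureOf (christoffelMap B G) y (B i) (B j) (B k)) (B l)
      = riemannDown B G i j k l y := by
  have hd : DifferentiableAt ℝ (christoffelMap B G) y :=
    ((contDiffOn_christoffelMap hT hG hdet).contDiffAt (hT.mem_nhds hy)).differentiableAt (by simp)
  have hc : ∀ i j k, DifferentiableAt ℝ (christoffel B G i j k) y := fun i j k =>
    ((contDiffOn_christoffel hT hG hdet i j k).contDiffAt (hT.mem_nhds hy)).differentiableAt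
      (by simp)
  have e : ∀ i j k, fderiv ℝ (christoffelMap B G) y (B i) (B j) (B k)
      = ∑ s, coordDeriv B i (christoffel B G s k j) y • B s := by
    intro i j k
    have h := (HasFDerivAt.bilin_apply (A := christoffelMap B G) hd.hasFDerivAt
      (hasFDerivAt_const (B j) y) (hasFDerivAt_const (B k) y)).2 (B i)
    simp only [zero_apply, map_zero, add_zero] at h
    rw [← h]
    simp only [christoffelMap_basis]
    rw [fderiv_fun_sum fun s _ => (hc s k j).smul_const (B s)]
    simp only [sum_apply]
    refine Finset.sum_congr rfl fun s _ => ?_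
    rw [fderiv_smul_const (hc s k j)]
    rfl
  have e2 : ∀ i j k, christoffelMap B G y (B i) (christoffelMap B G y (B j) (B k))
      = ∑ s, (∑ p, christoffel B G p k j y * christoffel B G s p i y) • B s := by
    intro i j k
    simp only [christoffelMap_basis, map_sum, map_smul, Finset.smul_sum, Finset.sum_smul, mul_smul]
    exact Finset.sum_comm
  have e3 : curvatureOf (christoffelMap B G) y (B i) (B j) (B k)
      = ∑ s, riemannUp B G i j k s y • B s := by
    simp only [curvatureOf, e, e2, ← Finset.sum_sub_distrib, ← Finset.sum_add_distrib,
      ← sub_smul, ← add_smul]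
    refine Finset.sum_congr rfl fun s _ => ?_
    rw [riemannUp, Finset.sum_sub_distrib, add_sub_assoc]
  rw [e3, riemannDown]
  simp only [map_sum, map_smul, sum_apply, smul_apply, metricMap_basis, smul_eq_mul]
  exact Finset.sum_congr rfl fun s _ => mul_comm _ _

theorem curvatureOf_add₁ (Γ : F → F →L[ℝ] F →L[ℝ] F) (y u u' v w : F) :
    curvatureOf Γ y (u + u') v w = curvatureOf Γ y u v w + curvatureOf Γ y u' v w := by
  simp only [curvatureOf, ContinuousLinearMap.map_add, add_apply]
  abel

theorem curvatureOf_smul₁ (Γ : F → F →L[ℝ] F →L[ℝ] F) (y u v w : F) (c : ℝ) :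
    curvatureOf Γ y (c • u) v w = c • curvatureOf Γ y u v w := by
  simp only [curvatureOf, ContinuousLinearMap.map_smul, smul_apply, smul_add, smul_sub]

theorem curvatureOf_swap (Γ : F → F →L[ℝ] F →L[ℝ] F) (y u v w : F) :
    curvatureOf Γ y u v w = -curvatureOf Γ y v u w := by
  simp only [curvatureOf]
  abel

theorem curvatureOf_add₂ (Γ : F → F →L[ℝ] F →L[ℝ] F) (y u v v' w : F) :
    curvatureOf Γ y u (v + v') w = curvatureOf Γ y u v w + curvatureOf Γ y u v' w := by
  rw [curvatureOf_swap, curvatureOf_add₁, neg_add, ← curvatureOf_swap, ← curvatureOf_swap]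

theorem curvatureOf_smul₂ (Γ : F → F →L[ℝ] F →L[ℝ] F) (y u v w : F) (c : ℝ) :
    curvatureOf Γ y u (c • v) w = c • curvatureOf Γ y u v w := by
  rw [curvatureOf_swap, curvatureOf_smul₁, ← smul_neg, ← curvatureOf_swap]

theorem curvatureOf_add₃ (Γ : F → F →L[ℝ] F →L[ℝ] F) (y u v w w' : F) :
    curvatureOf Γ y u v (w + w') = curvatureOf Γ y u v w + curvatureOf Γ y u v w' := by
  simp only [curvatureOf, ContinuousLinearMap.map_add]
  abel

theorem curvatureOf_smul₃ (Γ : F → F →L[ℝ] F →L[ℝ] F) (y u v w : F) (c : ℝ) :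
    curvatureOf Γ y u v (c • w) = c • curvatureOf Γ y u v w := by
  simp only [curvatureOf, ContinuousLinearMap.map_smul, smul_add, smul_sub]

/-- Both sides are linear in each of the four arguments, so this reduces to
`metricMap_curvatureOf_basis`. -/
theorem metricMap_curvatureOf {y : F} (hT : IsOpen T) (hy : y ∈ T)
    (hG : ∀ i j, ContDiffOn ℝ ∞ (fun y => G y i j) T)
    (hdet : ∀ y ∈ T, (G y).det ≠ 0) (u v w z : F) :
    metricMap B G y (curvatureOf (christoffelMap B G) y u v w) z
      = ∑ i, ∑ j, ∑ k, ∑ l, riemannDown B G i j k l y * B.repr u i * B.repr v j * B.repr w k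
        * B.repr z l := by
  set P : F → F → F → F → ℝ := fun u v w z =>
    metricMap B G y (curvatureOf (christoffelMap B G) y u v w) z with hP
  change P u v w z = _
  rw [eq_sum_repr_mul (B := B) (f := fun u => P u v w z)
    (by intros; simp only [hP, curvatureOf_add₁, ContinuousLinearMap.map_add, add_apply])
    (by intros; simp only [hP, curvatureOf_smul₁, ContinuousLinearMap.map_smul, smul_apply, smul_eq_mul])]
  refine Finset.sum_congr rfl fun i _ => ?_
  rw [eq_sum_repr_mul (B := B) (f := fun v => P (B i) v w z)
    (by intros; simp only [hP, curvatureOf_add₂, ContinuousLinearMap.map_add, add_apply])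
    (by intros; simp only [hP, curvatureOf_smul₂, ContinuousLinearMap.map_smul, smul_apply, smul_eq_mul]),
    Finset.mul_sum]
  refine Finset.sum_congr rfl fun j _ => ?_
  rw [eq_sum_repr_mul (B := B) (f := fun w => P (B i) (B j) w z)
    (by intros; simp only [hP, curvatureOf_add₃, ContinuousLinearMap.map_add, add_apply])
    (by intros; simp only [hP, curvatureOf_smul₃, ContinuousLinearMap.map_smul, smul_apply, smul_eq_mul]),
    Finset.mul_sum, Finset.mul_sum]
  refine Finset.sum_congr rfl fun k _ => ?_
  rw [eq_sum_repr_mul (B := B) (f := fun z => P (B i) (B j) (B k) z)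
    (by intros; simp only [hP, ContinuousLinearMap.map_add])
    (by intros; simp only [hP, ContinuousLinearMap.map_smul, smul_eq_mul]),
    Finset.mul_sum, Finset.mul_sum, Finset.mul_sum]
  refine Finset.sum_congr rfl fun l _ => ?_
  rw [← metricMap_curvatureOf_basis hT hy hG hdet i j k l]
  ring

theorem curvatureOf_self (Γ : F → F →L[ℝ] F →L[ℝ] F) (y v w : F) :
    curvatureOf Γ y v v w = 0 := by
  simp only [curvatureOf, sub_self, zero_add]

theorem curvatureOf_smul_self (Γ : F → F →L[ℝ] F →L[ℝ] F) (y v w : F) (c : ℝ) :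
    curvatureOf Γ y v (c • v) w = 0 := by
  rw [curvatureOf_smul₂, curvatureOf_self, smul_zero]

/-- The metric with coefficients `G` and its Levi-Civita connection in coordinates. -/
theorem isNonposCoordMetric (hT : IsOpen T)
    (hG : ∀ i j, ContDiffOn ℝ ∞ (fun y => G y i j) T)
    (hsymm : ∀ y ∈ T, (G y).IsSymm)
    (hpos : ∀ y ∈ T, ∀ v : F, v ≠ 0 → 0 < metricMap B G y v v)
    (hK : ∀ y ∈ T, ∀ u v : ι → ℝ, LinearIndependent ℝ ![u, v] →
      sectionalCurvature B G y u v ≤ 0) :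
    IsNonposCoordMetric T (metricMap B G) (christoffelMap B G) := by
  -- A kernel vector of the matrix would be a nonzero vector of length zero.
  have hdet : ∀ y ∈ T, (G y).det ≠ 0 := by
    intro y hy h0
    obtain ⟨v, hv, hv0⟩ := Matrix.exists_mulVec_eq_zero_iff.mpr h0
    have h := hpos y hy (B.equivFun.symm v)
      (by rwa [Ne, LinearEquiv.map_eq_zero_iff])
    have h' : metricForm G y v v = v ⬝ᵥ (G y).mulVec v := by
      simp only [metricForm, dotProduct, Matrix.mulVec, Finset.mul_sum]
      exact Finset.sum_congr rfl fun i _ => Finset.sum_congr rfl fun j _ => by ring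
    rw [metricMap_equivFun_symm, h', hv0] at h
    simp at h
  have gs : ∀ y ∈ T, ∀ v w, metricMap B G y v w = metricMap B G y w v := by
    intro y hy v w
    rw [metricMap_apply, metricMap_apply, Finset.sum_comm]
    refine Finset.sum_congr rfl fun i _ => Finset.sum_congr rfl fun j _ => ?_
    rw [(hsymm y hy).apply]; ring
  have nondeg : ∀ y ∈ T, ∀ v, (∀ w, metricMap B G y v w = 0) → v = 0 := by
    intro y hy v h
    by_contra hv
    exact (hpos y hy v hv).ne' (h v)
  have hd : ∀ y ∈ T, DifferentiableAt ℝ (metricMap B G) y := fun y hy =>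
    ((contDiffOn_metricMap hG).contDiffAt (hT.mem_nhds hy)).differentiableAt (by simp)
  have ds : ∀ y ∈ T, ∀ a v w, fderiv ℝ (metricMap B G) y a v w
      = fderiv ℝ (metricMap B G) y a w v := by
    intro y hy a v w
    rw [fderiv_metricMap_apply (hd y hy), fderiv_metricMap_apply (hd y hy)]
    have : (fun x => metricMap B G x v w) =ᶠ[nhds y] fun x => metricMap B G x w v := by
      filter_upwards [hT.mem_nhds hy] with x hx using gs x hx v w
    rw [this.fderiv_eq]
  have kz := fun y hy => metricMap_christoffelMap (B := B) (y := y) hT hy hG (hdet y hy)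
    hsymm
  refine ⟨contDiffOn_metricMap hG, contDiffOn_christoffelMap hT hG hdet, gs, hpos, ?_, ?_, ?_⟩
  · intro y hy v w
    rw [← sub_eq_zero]
    refine nondeg y hy _ fun z => ?_
    rw [map_sub, sub_apply, kz y hy, kz y hy, ds y hy z v w]
    ring
  · intro y hy w v v'
    rw [gs y hy v, kz y hy, kz y hy, ds y hy w v' v, ds y hy v w v', ds y hy v' w v]
    ring
  · intro y hy v w
    -- Sectional curvature constrains only independent pairs. For a dependent pair the curvature
    -- term is zero because it is alternating in the first two arguments.
    by_cases hvw : LinearIndependent ℝ ![v, w]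
    · have h := hK y hy (B.equivFun v) (B.equivFun w) (by
        rw [LinearIndependent.pair_iff] at hvw ⊢
        intro s t hst
        refine hvw s t (B.equivFun.injective ?_)
        rw [map_add, map_smul, map_smul, hst, map_zero])
      have hden : 0 < metricForm G y (B.equivFun v) (B.equivFun v)
          * metricForm G y (B.equivFun w) (B.equivFun w)
          - metricForm G y (B.equivFun v) (B.equivFun w) ^ 2 := by
        simp only [← metricMap_equivFun_symm (B := B), LinearEquiv.symm_apply_apply]
        have hw : 0 < metricMap B G y w w := hpos y hy w (by simpa using hvw.ne_zero 1)
        -- Strict Cauchy–Schwarz: the vector |w|²v - ⟨v, w⟩w is nonzero, and its squared length is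
        -- |w|² times the Gram determinant in question.
        have hz := hpos y hy (metricMap B G y w w • v - metricMap B G y v w • w) (by
          intro h0
          have := LinearIndependent.pair_iff.mp hvw (metricMap B G y w w)
            (-metricMap B G y v w) (by simpa [sub_eq_add_neg] using h0)
          exact hw.ne' this.1)
        simp only [map_sub, map_smul, sub_apply, smul_apply, smul_eq_mul, gs y hy w v] at hz
        refine pos_of_mul_pos_right ?_ hw.le (a := metricMap B G y w w)
        nlinarith
      rw [sectionalCurvature] at h
      rw [metricMap_curvatureOf hT hy hG hdet]
      by_contra! hn
      exact absurd h (not_le.mpr (div_pos hn hden))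
    · by_cases hv : v = 0
      · subst hv; simp
      · rw [LinearIndependent.pair_iff' hv] at hvw
        push Not at hvw
        obtain ⟨c, rfl⟩ := hvw
        simp [curvatureOf_smul_self]

/-- A torsion-free metric connection is the Levi-Civita connection. -/
theorem IsNonposCoordMetric.christoffel_unique {g : F → F →L[ℝ] F →L[ℝ] ℝ}
    {Γ : F → F →L[ℝ] F →L[ℝ] F} (h : IsNonposCoordMetric T g Γ) {y : F} (hy : y ∈ T)
    (C : F → F → F) (hC : ∀ v w, C v w = C w v)
    (hcompat : ∀ w v v', fderiv ℝ g y w v v' = g y (C w v) v' + g y v (C w v')) (v w : F) :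
    Γ y v w = C v w := by
  -- The difference of the two connections is symmetric in its two arguments and, lowered by the
  -- metric, skew in the last two slots. The Koszul combination of three compatibility identities
  -- shows that it vanishes.
  have key : ∀ z, g y (Γ y v w) z = g y (C v w) z := by
    intro z
    have a1 := h.compat y hy v w z
    have a2 := h.compat y hy w v z
    have a3 := h.compat y hy z v w
    rw [hcompat] at a1 a2 a3
    rw [h.torsion_free y hy w v, hC w v] at a2
    rw [h.torsion_free y hy z v, hC z v, h.torsion_free y hy z w, hC z w] at a3
    have := h.symm y hy (C v z) w
    have := h.symm y hy (Γ y v z) w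
    linarith
  by_contra hne
  have := h.pos y hy (Γ y v w - C v w) (sub_ne_zero.mpr hne)
  rw [(g y).map_sub, sub_apply, key, sub_self] at this
  exact lt_irrefl _ this

end Coordinates

/-! ### Holomorphic discs -/

section Disc

set_option linter.unusedSectionVars false

variable {Z : Type*} [NormedAddCommGroup Z] [NormedSpace ℂ Z] [NormedSpace ℝ Z]
  [IsScalarTower ℝ ℂ Z] {G : Type*} [NormedAddCommGroup G] [NormedSpace ℝ G]

/-- The quadratic holomorphic disc through `z` with velocity `W` and acceleration `V`. -/
noncomputable def disc (z W V : Z) (t : ℂ) : Z := z + t • W + (t ^ 2 / 2) • V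

@[simp] theorem disc_zero (z W V : Z) : disc z W V 0 = z := by simp [disc]

theorem hasFDerivAt_disc (z W V : Z) (t : ℂ) :
    HasFDerivAt (𝕜 := ℝ) (disc z W V)
      ((ContinuousLinearMap.toSpanSingleton ℂ (W + t • V)).restrictScalars ℝ) t := by
  have h : HasDerivAt (disc z W V) (W + t • V) t := by
    have h1 : HasDerivAt (fun t : ℂ => z + t • W) W t := by
      simpa using ((hasDerivAt_id t).smul_const W).const_add z
    have h2 : HasDerivAt (fun t : ℂ => (t ^ 2 / 2) • V) (t • V) t := by
      simpa using ((hasDerivAt_pow 2 t).div_const 2).smul_const V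
    exact h1.add h2
  exact h.hasFDerivAt.restrictScalars ℝ

theorem contDiff_disc (z W V : Z) : ContDiff ℝ ∞ (disc z W V) := by
  have h : ContDiff ℂ ∞ (disc z W V) := by unfold disc; fun_prop
  exact h.restrict_scalars ℝ

theorem fderiv_comp_disc {φ : Z → G} {z W V : Z} {t : ℂ}
    (hφ : DifferentiableAt ℝ φ (disc z W V t)) (a : ℂ) :
    fderiv ℝ (fun s => φ (disc z W V s)) t a = fderiv ℝ φ (disc z W V t) (a • (W + t • V)) := by
  have h : HasFDerivAt (fun s => φ (disc z W V s)) _ t :=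
    HasFDerivAt.comp t hφ.hasFDerivAt (hasFDerivAt_disc z W V t)
  rw [h.fderiv]
  simp

/-- The acceleration enters only through a²V. In the Laplacian, the sum over a = 1 and a = i, these
contributions cancel; this is the reason for using holomorphic discs. -/
theorem secondDirDeriv_comp_disc {φ : Z → G} {z W V : Z} {t : ℂ}
    (hφ : ContDiffAt ℝ 2 φ (disc z W V t)) (a : ℂ) :
    secondDirDeriv (fun s => φ (disc z W V s)) a t
      = fderiv ℝ (fderiv ℝ φ) (disc z W V t) (a • (W + t • V)) (a • (W + t • V))
        + fderiv ℝ φ (disc z W V t) (a • a • V) := by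
  have hev : ∀ᶠ s in nhds t, ContDiffAt ℝ 2 φ (disc z W V s) :=
    (contDiff_disc z W V).continuous.continuousAt.eventually (hφ.eventually (by simp))
  have e : (fun s => fderiv ℝ (fun s => φ (disc z W V s)) s a)
      =ᶠ[nhds t] fun s => fderiv ℝ φ (disc z W V s) (a • (W + s • V)) := by
    filter_upwards [hev] with s hs
    exact fderiv_comp_disc (hs.differentiableAt (by norm_num)) a
  have hd : DifferentiableAt ℝ (fderiv ℝ φ) (disc z W V t) :=
    (hφ.fderiv_right (m := 1) (by norm_num)).differentiableAt (by norm_num)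
  have h1 : HasFDerivAt (fun s => fderiv ℝ φ (disc z W V s)) _ t :=
    HasFDerivAt.comp t hd.hasFDerivAt (hasFDerivAt_disc z W V t)
  have h2 : HasFDerivAt (𝕜 := ℝ) (fun s : ℂ => a • (W + s • V))
      ((ContinuousLinearMap.toSpanSingleton ℂ (a • V)).restrictScalars ℝ) t := by
    have : HasDerivAt (fun s : ℂ => a • (W + s • V)) (a • V) t := by
      have h := ((hasDerivAt_id t).smul_const V).const_add W
      rw [one_smul] at h
      exact h.const_smul a
    exact this.hasFDerivAt.restrictScalars ℝ
  rw [secondDirDeriv, e.fderiv_eq, (h1.clm_apply h2).fderiv]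
  simp only [add_apply, ContinuousLinearMap.comp_apply, ContinuousLinearMap.flip_apply,
    ContinuousLinearMap.coe_restrictScalars', ContinuousLinearMap.toSpanSingleton_apply]
  rw [add_comm]

/-- The shape of one term h_{γδ̄} c'^γ c̄'^δ of the squared velocity of a disc: c' is affine in the
parameter, so its components have no second derivatives. -/
theorem secondDirDeriv_mul_affine {A : ℂ → ℂ} {t : ℂ} (hA : ContDiffAt ℝ 2 A t)
    (w v w' v' a : ℂ) :
    secondDirDeriv (fun s => A s * (w + s * v) * star (w' + s * v')) a t
      = secondDirDeriv A a t * (w + t * v) * star (w' + t * v')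
        + 2 * fderiv ℝ A t a * (a * v * star (w' + t * v') + (w + t * v) * star (a * v'))
        + 2 * A t * (a * v) * star (a * v') := by
  have hB : ∀ s : ℂ, HasFDerivAt (𝕜 := ℝ) (fun s : ℂ => w + s * v)
      ((ContinuousLinearMap.toSpanSingleton ℂ v).restrictScalars ℝ) s := fun s => by
    have : HasDerivAt (fun s : ℂ => w + s * v) v s := by
      simpa using ((hasDerivAt_id s).mul_const v).const_add w
    exact this.hasFDerivAt.restrictScalars ℝ
  have hC : ∀ s : ℂ, HasFDerivAt (𝕜 := ℝ) (fun s : ℂ => star (w' + s * v'))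
      (Complex.conjCLE.toContinuousLinearMap.comp
        ((ContinuousLinearMap.toSpanSingleton ℂ v').restrictScalars ℝ)) s := fun s => by
    have : HasDerivAt (fun s : ℂ => w' + s * v') v' s := by
      simpa using ((hasDerivAt_id s).mul_const v').const_add w'
    exact Complex.conjCLE.toContinuousLinearMap.hasFDerivAt.comp s
      (this.hasFDerivAt.restrictScalars ℝ)
  have hev : ∀ᶠ s in nhds t, ContDiffAt ℝ 2 A s := hA.eventually (by simp)
  have e : (fun s => fderiv ℝ (fun s => A s * (w + s * v) * star (w' + s * v')) s a)
      =ᶠ[nhds t] fun s => fderiv ℝ A s a * (w + s * v) * star (w' + s * v')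
        + A s * (a * v) * star (w' + s * v') + A s * (w + s * v) * star (a * v') := by
    filter_upwards [hev] with s hs
    have h := (((hs.differentiableAt (by norm_num)).hasFDerivAt.mul (hB s)).mul (hC s)).fderiv
    have h' : fderiv ℝ (fun s => A s * (w + s * v) * star (w' + s * v')) s = _ := h
    rw [h']
    simp
    ring
  have hd : DifferentiableAt ℝ (fderiv ℝ A) t :=
    (hA.fderiv_right (m := 1) (by norm_num)).differentiableAt (by norm_num)
  have h0 : HasFDerivAt A (fderiv ℝ A t) t := (hA.differentiableAt (by norm_num)).hasFDerivAt
  have h1 : HasFDerivAt (fun s => fderiv ℝ A s a) (fderiv ℝ (fun s => fderiv ℝ A s a) t) t :=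
    (hd.clm_apply (differentiableAt_const a)).hasFDerivAt
  have h2 : HasFDerivAt (fun s => fderiv ℝ A s a * (w + s * v) * star (w' + s * v')
        + A s * (a * v) * star (w' + s * v') + A s * (w + s * v) * star (a * v')) _ t :=
    (((h1.mul (hB t)).mul (hC t)).add ((h0.mul_const (a * v)).mul (hC t))).add
      ((h0.mul (hB t)).mul_const (star (a * v')))
  rw [secondDirDeriv, e.fderiv_eq, h2.fderiv, secondDirDeriv]
  simp
  ring

end Disc

/-! ### Wirtinger derivatives and real derivatives -/

section Wirtinger

variable {m : ℕ}

theorem euclidean_eq_sum (w : EuclideanSpace ℂ (Fin m)) :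
    w = ∑ α, ((w α).re • EuclideanSpace.single α (1 : ℂ)
      + (w α).im • EuclideanSpace.single α Complex.I) := by
  ext β
  simp [Pi.single_apply, Finset.sum_add_distrib]

theorem realLinear_eq_sum (L : EuclideanSpace ℂ (Fin m) →L[ℝ] ℂ) (w : EuclideanSpace ℂ (Fin m)) :
    L w = ∑ α, (((w α).re : ℂ) * L (EuclideanSpace.single α 1)
      + ((w α).im : ℂ) * L (EuclideanSpace.single α Complex.I)) := by
  conv_lhs => rw [euclidean_eq_sum w]
  simp

/-- The left side is the (1,0) part of the real differential, evaluated on `w`. This and its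
conjugate counterpart let all index computations be done with real derivatives in the two directions
`w` and `I • w`. -/
theorem sum_mul_wirtinger (φ : EuclideanSpace ℂ (Fin m) → ℂ) (z w : EuclideanSpace ℂ (Fin m)) :
    ∑ α, w α * wirtinger α φ z
      = (1 / 2) * (fderiv ℝ φ z w - Complex.I * fderiv ℝ φ z (Complex.I • w)) := by
  rw [realLinear_eq_sum (fderiv ℝ φ z) w, realLinear_eq_sum (fderiv ℝ φ z) (Complex.I • w),
    Finset.mul_sum, ← Finset.sum_sub_distrib, Finset.mul_sum]
  refine Finset.sum_congr rfl fun α _ => ?_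
  rw [wirtinger]
  have hw := (Complex.re_add_im (w α)).symm
  simp
  linear_combination ((1 / 2) * (fderiv ℝ φ z (EuclideanSpace.single α 1)
    - Complex.I * fderiv ℝ φ z (EuclideanSpace.single α Complex.I))) * hw
    - ((w α).im * fderiv ℝ φ z (EuclideanSpace.single α Complex.I) / 2) * Complex.I_sq

theorem sum_star_mul_wirtingerBar (φ : EuclideanSpace ℂ (Fin m) → ℂ)
    (z w : EuclideanSpace ℂ (Fin m)) :
    ∑ α, star (w α) * wirtingerBar α φ z
      = (1 / 2) * (fderiv ℝ φ z w + Complex.I * fderiv ℝ φ z (Complex.I • w)) := by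
  rw [realLinear_eq_sum (fderiv ℝ φ z) w, realLinear_eq_sum (fderiv ℝ φ z) (Complex.I • w),
    Finset.mul_sum, ← Finset.sum_add_distrib, Finset.mul_sum]
  refine Finset.sum_congr rfl fun α _ => ?_
  rw [wirtingerBar]
  have hw : star (w α) = (w α).re - (w α).im * Complex.I := by
    apply Complex.ext <;> simp
  rw [hw]
  simp
  linear_combination
    - ((w α).im * fderiv ℝ φ z (EuclideanSpace.single α Complex.I) / 2) * Complex.I_sq

theorem star_wirtinger (φ : EuclideanSpace ℂ (Fin m) → ℂ) (z : EuclideanSpace ℂ (Fin m))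
    (α : Fin m) : star (wirtinger α φ z) = wirtingerBar α (fun w => star (φ w)) z := by
  have h : fderiv ℝ (fun w => star (φ w)) z
      = Complex.conjCLE.toContinuousLinearMap.comp (fderiv ℝ φ z) :=
    Complex.conjCLE.comp_fderiv
  rw [wirtinger, wirtingerBar, h]
  simp

/-- The Levi form in terms of real second derivatives. -/
theorem sum_wirtinger_wirtingerBar {φ : EuclideanSpace ℂ (Fin m) → ℂ}
    {z : EuclideanSpace ℂ (Fin m)} (hφ : ContDiffAt ℝ 2 φ z) (w : EuclideanSpace ℂ (Fin m)) :
    ∑ α, ∑ β, wirtinger α (wirtingerBar β φ) z * w α * star (w β)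
      = (1 / 4) * (fderiv ℝ (fderiv ℝ φ) z w w
        + fderiv ℝ (fderiv ℝ φ) z (Complex.I • w) (Complex.I • w)) := by
  have hd : DifferentiableAt ℝ (fderiv ℝ φ) z :=
    (hφ.fderiv_right (m := 1) (by norm_num)).differentiableAt (by norm_num)
  have hdv : ∀ v, HasFDerivAt (fun ζ => fderiv ℝ φ ζ v) ((fderiv ℝ (fderiv ℝ φ) z).flip v) z :=
    fun v => by simpa using hd.hasFDerivAt.clm_apply (hasFDerivAt_const v z)
  have hb : ∀ β, DifferentiableAt ℝ (wirtingerBar β φ) z := fun β =>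
    ((hdv _).differentiableAt.add ((hdv _).differentiableAt.const_mul _)).const_mul _
  -- Since `w` is constant, the sum over `β` can be moved inside the outer derivative, where it
  -- becomes the (0,1) part of the differential on `w`.
  have e1 : ∀ α, ∑ β, wirtinger α (wirtingerBar β φ) z * w α * star (w β)
      = w α * wirtinger α (fun ζ => (1 / 2 : ℂ) * (fderiv ℝ φ ζ w
          + Complex.I * fderiv ℝ φ ζ (Complex.I • w))) z := by
    intro α
    have e2 : (fun ζ => (1 / 2 : ℂ) * (fderiv ℝ φ ζ w
          + Complex.I * fderiv ℝ φ ζ (Complex.I • w)))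
        = fun ζ => ∑ β, star (w β) * wirtingerBar β φ ζ :=
      funext fun ζ => (sum_star_mul_wirtingerBar φ ζ w).symm
    have e3 : fderiv ℝ (fun ζ => ∑ β, star (w β) * wirtingerBar β φ ζ) z
        = ∑ β, star (w β) • fderiv ℝ (wirtingerBar β φ) z := by
      rw [fderiv_fun_sum fun β _ => (hb β).const_mul _]
      exact Finset.sum_congr rfl fun β _ => fderiv_const_mul (hb β) _
    rw [e2, wirtinger, e3]
    simp only [wirtinger, sum_apply, smul_apply, smul_eq_mul, Finset.mul_sum,
      ← Finset.sum_sub_distrib]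
    exact Finset.sum_congr rfl fun β _ => by ring
  have hF := ((hdv w).add ((hdv (Complex.I • w)).const_mul Complex.I)).const_mul (1 / 2 : ℂ)
  have hF' : fderiv ℝ (fun ζ => (1 / 2 : ℂ) * (fderiv ℝ φ ζ w
          + Complex.I * fderiv ℝ φ ζ (Complex.I • w))) z = _ := hF.fderiv
  rw [Finset.sum_congr rfl fun α _ => e1 α, sum_mul_wirtinger, hF']
  -- The mixed second derivatives along `w` and `I • w` occur with opposite signs, so symmetry
  -- removes them.
  have hsym := (hφ.isSymmSndFDerivAt (by simp)).eq w (Complex.I • w)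
  simp [hsym]
  linear_combination (-(1 / 4) * fderiv ℝ (fderiv ℝ φ) z (Complex.I • w) (Complex.I • w))
    * Complex.I_sq

end Wirtinger

/-! ### Hermitian metrics in holomorphic charts -/

/-! ### Linearity of second directional derivatives -/

section SecondDirDeriv

variable {E : Type*} [NormedAddCommGroup E] [NormedSpace ℝ E]
  {G : Type*} [NormedAddCommGroup G] [NormedSpace ℝ G]
  {G' : Type*} [NormedAddCommGroup G'] [NormedSpace ℝ G']

theorem ContDiffAt.differentiableAt_fderiv_apply {Φ : E → G} {t : E} (h : ContDiffAt ℝ 2 Φ t)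
    (a : E) : DifferentiableAt ℝ (fun s => fderiv ℝ Φ s a) t :=
  ((h.fderiv_right (m := 1) (by norm_num)).differentiableAt (by norm_num)).clm_apply
    (differentiableAt_const a)

theorem secondDirDeriv_sum {κ : Type*} {S : Finset κ} {Φ : κ → E → G} {t : E}
    (h : ∀ k ∈ S, ContDiffAt ℝ 2 (Φ k) t) (a : E) :
    secondDirDeriv (fun s => ∑ k ∈ S, Φ k s) a t = ∑ k ∈ S, secondDirDeriv (Φ k) a t := by
  have hev : ∀ᶠ s in nhds t, ∀ k ∈ S, ContDiffAt ℝ 2 (Φ k) s :=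
    (Filter.eventually_all_finset S).mpr fun k hk => (h k hk).eventually (by simp)
  have e : (fun s => fderiv ℝ (fun s => ∑ k ∈ S, Φ k s) s a)
      =ᶠ[nhds t] fun s => ∑ k ∈ S, fderiv ℝ (Φ k) s a := by
    filter_upwards [hev] with s hs
    rw [fderiv_fun_sum fun k hk => (hs k hk).differentiableAt (by norm_num), sum_apply]
  rw [secondDirDeriv, e.fderiv_eq,
    fderiv_fun_sum fun k hk => (h k hk).differentiableAt_fderiv_apply a, sum_apply]
  rfl

theorem secondDirDeriv_clm_comp (L : G →L[ℝ] G') {Φ : E → G} {t : E} (h : ContDiffAt ℝ 2 Φ t)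
    (a : E) : secondDirDeriv (fun s => L (Φ s)) a t = L (secondDirDeriv Φ a t) := by
  have e : (fun s => fderiv ℝ (fun s => L (Φ s)) s a) =ᶠ[nhds t] fun s => L (fderiv ℝ Φ s a) := by
    filter_upwards [h.eventually (by simp)] with s hs
    have : fderiv ℝ (fun s => L (Φ s)) s = _ :=
      (L.hasFDerivAt.comp s (hs.differentiableAt (by norm_num)).hasFDerivAt).fderiv
    rw [this]; rfl
  have h2 : fderiv ℝ (fun s => L (fderiv ℝ Φ s a)) t = _ :=
    (L.hasFDerivAt.comp t (h.differentiableAt_fderiv_apply a).hasFDerivAt).fderiv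
  rw [secondDirDeriv, e.fderiv_eq, h2]
  rfl

end SecondDirDeriv

/-! ### Metric coefficients and Chern curvature along holomorphic discs -/

section HermitianCoefficients

set_option linter.unusedSectionVars false

variable {m : ℕ} {M : Type*} [TopologicalSpace M] [ChartedSpace (EuclideanSpace ℂ (Fin m)) M]
  {e : OpenPartialHomeomorph M (EuclideanSpace ℂ (Fin m))}

theorem holoVec_eq_sum (z w : EuclideanSpace ℂ (Fin m)) :
    holoVec e z w = ∑ α, w α • holoVec e z (EuclideanSpace.single α 1) := by
  have h : w = ∑ α, w α • EuclideanSpace.single α (1 : ℂ) := by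
    ext β
    simp [Pi.single_apply]
  conv_lhs => rw [h]
  exact (map_sum (mfderiv 𝓘(ℂ, EuclideanSpace ℂ (Fin m)) 𝓘(ℂ, EuclideanSpace ℂ (Fin m)) e.symm z)
    _ _).trans (Finset.sum_congr rfl fun α _ => ContinuousLinearMap.map_smul
      (mfderiv 𝓘(ℂ, EuclideanSpace ℂ (Fin m)) 𝓘(ℂ, EuclideanSpace ℂ (Fin m)) e.symm z) _ _)

theorem holoVec_smul (z w : EuclideanSpace ℂ (Fin m)) (c : ℂ) :
    holoVec e z (c • w) = c • holoVec e z w :=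
  ContinuousLinearMap.map_smul
    (mfderiv 𝓘(ℂ, EuclideanSpace ℂ (Fin m)) 𝓘(ℂ, EuclideanSpace ℂ (Fin m)) e.symm z) c w

theorem holoVec_zero (z : EuclideanSpace ℂ (Fin m)) : holoVec e z 0 = 0 := by
  simpa using holoVec_smul (e := e) z 0 0

namespace HermitianMetric

variable (h : HermitianMetric m M)

theorem inner_holoVec (z v w : EuclideanSpace ℂ (Fin m)) :
    h.inner (e.symm z) (holoVec e z v) (holoVec e z w)
      = ∑ α, ∑ β, h.coeff e z α β * v α * star (w β) := by
  rw [holoVec_eq_sum z v, holoVec_eq_sum z w]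
  simp only [map_sum, LinearMap.sum_apply, map_smul, LinearMap.smul_apply, LinearMap.map_smulₛₗ,
    smul_eq_mul, coeff, Matrix.of_apply, Finset.mul_sum]
  rw [Finset.sum_comm]
  refine Finset.sum_congr rfl fun α _ => Finset.sum_congr rfl fun β _ => ?_
  simp
  ring

theorem star_coeff (z : EuclideanSpace ℂ (Fin m)) (α β : Fin m) :
    star (h.coeff e z β α) = h.coeff e z α β :=
  h.conj_symm _ _ _

variable [IsManifold 𝓘(ℂ, EuclideanSpace ℂ (Fin m)) ω M]

theorem _root_.holoCharts_mdifferentiable (he : e ∈ holoCharts m M) :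
    e.MDifferentiable 𝓘(ℂ, EuclideanSpace ℂ (Fin m)) 𝓘(ℂ, EuclideanSpace ℂ (Fin m)) :=
  ⟨(contMDiffOn_of_mem_maximalAtlas he).mdifferentiableOn (by simp),
    (contMDiffOn_symm_of_mem_maximalAtlas he).mdifferentiableOn (by simp)⟩

theorem _root_.holoVec_bijective (he : e ∈ holoCharts m M) {z : EuclideanSpace ℂ (Fin m)}
    (hz : z ∈ e.target) : Function.Bijective (holoVec e z) :=
  (holoCharts_mdifferentiable he).symm.mfderiv_bijective hz

theorem _root_.holoVec_ne_zero (he : e ∈ holoCharts m M) {z w : EuclideanSpace ℂ (Fin m)}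
    (hz : z ∈ e.target) (hw : w ≠ 0) : holoVec e z w ≠ 0 := by
  intro h0
  exact hw ((holoVec_bijective he hz).1 (h0.trans (holoVec_zero z).symm))

theorem coeff_pos (he : e ∈ holoCharts m M) {z w : EuclideanSpace ℂ (Fin m)}
    (hz : z ∈ e.target) (hw : w ≠ 0) :
    0 < (∑ α, ∑ β, h.coeff e z α β * w α * star (w β)).re := by
  rw [← inner_holoVec]
  exact h.pos _ _ (holoVec_ne_zero he hz hw)

theorem det_coeff_ne_zero (he : e ∈ holoCharts m M) {z : EuclideanSpace ℂ (Fin m)}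
    (hz : z ∈ e.target) : (h.coeff e z).det ≠ 0 := by
  intro h0
  obtain ⟨v, hv, hv0⟩ := Matrix.exists_vecMul_eq_zero_iff.mpr h0
  have hp := h.coeff_pos he hz (w := WithLp.toLp 2 v) (by simpa using hv)
  have : ∑ α, ∑ β, h.coeff e z α β * v α * star (v β) = 0 := by
    rw [Finset.sum_comm]
    refine Finset.sum_eq_zero fun β _ => ?_
    rw [← Finset.sum_mul]
    have := congrFun hv0 β
    simp only [Matrix.vecMul, dotProduct, Pi.zero_apply] at this
    rw [Finset.sum_congr rfl fun α _ => mul_comm _ _, this, zero_mul]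
  simp only [this] at hp
  simp at hp

theorem contDiffOn_coeff (he : e ∈ holoCharts m M) (α β : Fin m) :
    ContDiffOn ℝ ∞ (fun z => h.coeff e z α β) e.target := h.smooth e he α β

end HermitianMetric

/-- Laplacian of one component of a metric along a holomorphic disc. -/
theorem laplacian_coeff_disc {φ : EuclideanSpace ℂ (Fin m) → ℂ} {z W V : EuclideanSpace ℂ (Fin m)}
    (hφ : ContDiffAt ℝ 2 φ z) (γ δ : Fin m) :
    secondDirDeriv (fun s => φ (disc z W V s) * (W γ + s * V γ) * star (W δ + s * V δ)) 1 0
      + secondDirDeriv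
        (fun s => φ (disc z W V s) * (W γ + s * V γ) * star (W δ + s * V δ)) Complex.I 0
      = 4 * ((∑ α, ∑ β, wirtinger α (wirtingerBar β φ) z * W α * star (W β)) * W γ * star (W δ)
        + (∑ ν, star (W ν) * wirtingerBar ν φ z) * V γ * star (W δ)
        + (∑ μ, W μ * wirtinger μ φ z) * W γ * star (V δ)
        + φ z * V γ * star (V δ)) := by
  have hφ' : ContDiffAt ℝ 2 φ (disc z W V 0) := by simpa using hφ
  have hA : ContDiffAt ℝ 2 (fun s => φ (disc z W V s)) 0 :=
    hφ'.comp 0 ((contDiff_disc z W V).contDiffAt.of_le (by norm_cast))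
  have hd := hφ'.differentiableAt (by norm_num)
  -- Adding the directions 1 and i turns the pure second derivatives into the Levi form and the two
  -- first-order terms into a ∂̄- and a ∂-derivative along `W`.
  rw [secondDirDeriv_mul_affine hA, secondDirDeriv_mul_affine hA, secondDirDeriv_comp_disc hφ',
    secondDirDeriv_comp_disc hφ', fderiv_comp_disc hd, fderiv_comp_disc hd,
    sum_wirtinger_wirtingerBar hφ, sum_star_mul_wirtingerBar, sum_mul_wirtinger]
  simp only [disc_zero, zero_smul, zero_mul, add_zero, one_smul, one_mul, smul_smul,
    Complex.I_mul_I, neg_smul, map_neg, star_mul', Complex.star_def, Complex.conj_I]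
  linear_combination (-2 * φ z * V γ * (starRingEnd ℂ) (V δ)) * Complex.I_sq

theorem sum_pull_out₃ {ι R : Type*} [Fintype ι] [AddCommMonoid R] (f : ι → ι → ι → R) :
    ∑ i, ∑ j, ∑ k, f i j k = ∑ k, ∑ i, ∑ j, f i j k :=
  (Finset.sum_congr rfl fun _ _ => Finset.sum_comm).trans Finset.sum_comm

theorem sum_pull_out₅ {ι R : Type*} [Fintype ι] [AddCommMonoid R] (f : ι → ι → ι → ι → ι → R) :
    ∑ i, ∑ j, ∑ k, ∑ l, ∑ a, f i j k l a = ∑ a, ∑ i, ∑ j, ∑ k, ∑ l, f i j k l a :=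
  (Finset.sum_congr rfl fun _ _ => Finset.sum_congr rfl fun _ _ => sum_pull_out₃ _).trans
    (sum_pull_out₃ _)

/-- Regroups the contracted curvature into a Levi term and a product of contracted first
derivatives, the shape in which it meets the Laplacian of the squared velocity. -/
theorem sum_curvature_expand {ι R : Type*} [Fintype ι] [CommRing R] (D : ι → ι → ι → ι → R)
    (K : ι → ι → R) (P Q : ι → ι → ι → R) (W W' : ι → R) :
    ∑ μ, ∑ ν, ∑ γ, ∑ δ, (-D μ ν γ δ + ∑ α, ∑ β, K α β * P μ γ β * Q ν α δ)
        * W μ * W' ν * W γ * W' δ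
      = -∑ γ, ∑ δ, (∑ μ, ∑ ν, D μ ν γ δ * W μ * W' ν) * W γ * W' δ
        + ∑ α, ∑ β, K α β * (∑ γ, (∑ μ, W μ * P μ γ β) * W γ)
          * ∑ δ, (∑ ν, W' ν * Q ν α δ) * W' δ := by
  have h : ∀ μ ν γ δ, (-D μ ν γ δ + ∑ α, ∑ β, K α β * P μ γ β * Q ν α δ)
      * W μ * W' ν * W γ * W' δ = -(D μ ν γ δ * W μ * W' ν * W γ * W' δ)
        + ∑ α, ∑ β, K α β * P μ γ β * Q ν α δ * W μ * W' ν * W γ * W' δ := by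
    intro μ ν γ δ
    simp only [add_mul, neg_mul, Finset.sum_mul]
  simp only [h, Finset.sum_add_distrib, Finset.sum_neg_distrib]
  refine congrArg₂ (· + ·) (congrArg (- ·) ?_) ?_
  · simp only [Finset.sum_mul]
    rw [sum_pull_out₃]
    exact Finset.sum_congr rfl fun γ _ => sum_pull_out₃ _
  · rw [sum_pull_out₅]
    refine Finset.sum_congr rfl fun α _ => ?_
    rw [sum_pull_out₅]
    refine Finset.sum_congr rfl fun β _ => ?_
    rw [sum_pull_out₃, mul_assoc, Finset.sum_mul, Finset.mul_sum]
    refine Finset.sum_congr rfl fun γ _ => ?_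
    rw [Finset.sum_mul, Finset.sum_mul, Finset.mul_sum]
    refine Finset.sum_congr rfl fun μ _ => ?_
    rw [Finset.sum_comm, Finset.mul_sum, Finset.mul_sum]
    refine Finset.sum_congr rfl fun δ _ => ?_
    rw [Finset.sum_mul, Finset.mul_sum, Finset.mul_sum]
    exact Finset.sum_congr rfl fun ν _ => by ring

/-- Along a suitable holomorphic disc in the direction `W`, the Laplacian of the squared length
of the velocity is minus four times the holomorphic sectional curvature (unnormalized). -/
theorem HermitianMetric.exists_disc_laplacian [IsManifold 𝓘(ℂ, EuclideanSpace ℂ (Fin m)) ω M]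
    (h : HermitianMetric m M) (he : e ∈ holoCharts m M) {z : EuclideanSpace ℂ (Fin m)}
    (hz : z ∈ e.target) (W : EuclideanSpace ℂ (Fin m)) : ∃ V : EuclideanSpace ℂ (Fin m),
      secondDirDeriv (fun t => (∑ α, ∑ β, h.coeff e (disc z W V t) α β * (W + t • V) α
          * star ((W + t • V) β)).re) 1 0
        + secondDirDeriv (fun t => (∑ α, ∑ β, h.coeff e (disc z W V t) α β * (W + t • V) α
          * star ((W + t • V) β)).re) Complex.I 0
      = -4 * (∑ μ, ∑ ν, ∑ γ, ∑ δ,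
          h.chernCurvature e μ ν γ δ z * W μ * star (W ν) * W γ * star (W δ)).re := by
  have hk : ∀ α β, ContDiffAt ℝ 2 (fun z => h.coeff e z α β) z := fun α β =>
    ((h.contDiffOn_coeff he α β).contDiffAt (e.open_target.mem_nhds hz)).of_le (by norm_cast)
  set A : Fin m → ℂ := fun δ => ∑ γ, (∑ μ, W μ * wirtinger μ (fun w => h.coeff e w γ δ) z) * W γ
    with hA
  set A' : Fin m → ℂ := fun α =>
    ∑ δ, (∑ ν, star (W ν) * wirtingerBar ν (fun w => h.coeff e w α δ) z) * star (W δ) with hA'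
  -- In index form V^α = -h^{αβ̄} A_β, which is -Γ^α_{μγ} W^μ W^γ for the Chern connection: the disc
  -- has zero covariant acceleration at its centre.
  set V : EuclideanSpace ℂ (Fin m) := WithLp.toLp 2 (-Matrix.vecMul A (h.coeff e z)⁻¹) with hV
  have hVα : ∀ α, V α = -∑ β, A β * (h.coeff e z)⁻¹ β α := fun α => rfl
  have hVH : ∀ δ, ∑ α, V α * h.coeff e z α δ = -A δ := by
    intro δ
    have h1 : Matrix.vecMul (-Matrix.vecMul A (h.coeff e z)⁻¹) (h.coeff e z) = -A := by
      rw [Matrix.neg_vecMul, Matrix.vecMul_vecMul, Matrix.nonsing_inv_mul _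
        (isUnit_iff_ne_zero.mpr (h.det_coeff_ne_zero he hz)), Matrix.vecMul_one]
    exact congrFun h1 δ
  refine ⟨V, ?_⟩
  set P : Fin m → Fin m → ℂ → ℂ := fun γ δ t =>
    h.coeff e (disc z W V t) γ δ * (W γ + t * V γ) * star (W δ + t * V δ) with hP
  have hPd : ∀ γ δ, ContDiffAt ℝ 2 (P γ δ) 0 := by
    intro γ δ
    have hk' : ContDiffAt ℝ 2 (fun z => h.coeff e z γ δ) (disc z W V 0) := by
      simpa using hk γ δ
    have h1 : ContDiffAt ℝ 2 (fun t => h.coeff e (disc z W V t) γ δ) 0 :=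
      hk'.comp 0 ((contDiff_disc z W V).contDiffAt.of_le (by norm_cast))
    have h2 : ContDiff ℝ 2 fun t : ℂ => W γ + t * V γ := by fun_prop
    have h3 : ContDiff ℝ 2 fun t : ℂ => star (W δ + t * V δ) :=
      Complex.conjCLE.contDiff.comp (by fun_prop : ContDiff ℝ 2 fun t : ℂ => W δ + t * V δ)
    exact (h1.mul h2.contDiffAt).mul h3.contDiffAt
  have hsum : ∀ a : ℂ, secondDirDeriv (fun t => (∑ α, ∑ β, h.coeff e (disc z W V t) α β
      * (W + t • V) α * star ((W + t • V) β)).re) a 0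
      = (∑ γ, ∑ δ, secondDirDeriv (P γ δ) a 0).re := by
    intro a
    have h1 := secondDirDeriv_clm_comp Complex.reCLM
      (ContDiffAt.sum fun γ (_ : γ ∈ Finset.univ) =>
        ContDiffAt.sum fun δ (_ : δ ∈ Finset.univ) => hPd γ δ) a
    rw [secondDirDeriv_sum fun γ _ => ContDiffAt.sum fun δ _ => hPd γ δ,
      Finset.sum_congr rfl fun γ _ => secondDirDeriv_sum (fun δ _ => hPd γ δ) a] at h1
    exact h1
  rw [hsum, hsum, ← Complex.add_re, ← Finset.sum_add_distrib,
    Finset.sum_congr rfl fun γ _ => Finset.sum_add_distrib.symm,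
    Finset.sum_congr rfl fun γ _ => Finset.sum_congr rfl fun δ _ =>
      laplacian_coeff_disc (hk γ δ) γ δ]
  set L : ℂ := ∑ γ, ∑ δ, (∑ α, ∑ β, wirtinger α (wirtingerBar β (fun w => h.coeff e w γ δ)) z
    * W α * star (W β)) * W γ * star (W δ) with hL
  have e1 : ∑ γ, ∑ δ, 4 * ((∑ α, ∑ β, wirtinger α (wirtingerBar β (fun w => h.coeff e w γ δ)) z
        * W α * star (W β)) * W γ * star (W δ)
        + (∑ ν, star (W ν) * wirtingerBar ν (fun w => h.coeff e w γ δ) z) * V γ * star (W δ)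
        + (∑ μ, W μ * wirtinger μ (fun w => h.coeff e w γ δ) z) * W γ * star (V δ)
        + h.coeff e z γ δ * V γ * star (V δ)) = 4 * (L + ∑ γ, V γ * A' γ) := by
    simp only [← Finset.mul_sum, Finset.sum_add_distrib]
    have s1 : ∑ γ, ∑ δ, (∑ ν, star (W ν) * wirtingerBar ν (fun w => h.coeff e w γ δ) z) * V γ
        * star (W δ) = ∑ γ, V γ * A' γ := by
      refine Finset.sum_congr rfl fun γ _ => ?_
      rw [hA', Finset.mul_sum]
      exact Finset.sum_congr rfl fun δ _ => by ring
    have s2 : ∑ γ, ∑ δ, (∑ μ, W μ * wirtinger μ (fun w => h.coeff e w γ δ) z) * W γ * star (V δ)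
        = ∑ δ, A δ * star (V δ) := by
      rw [Finset.sum_comm]
      exact Finset.sum_congr rfl fun δ _ => (Finset.sum_mul _ _ _).symm
    -- By the choice of `V` the term quadratic in `V` cancels the one containing only `star V`. The
    -- surviving linear term V^γ A'_γ supplies the product of first derivatives in the Chern
    -- curvature.
    have s3 : ∑ γ, ∑ δ, h.coeff e z γ δ * V γ * star (V δ) = -∑ δ, A δ * star (V δ) := by
      rw [Finset.sum_comm, ← Finset.sum_neg_distrib]
      refine Finset.sum_congr rfl fun δ _ => ?_
      rw [← Finset.sum_mul, ← neg_mul, ← hVH δ]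
      exact congrArg (· * _) (Finset.sum_congr rfl fun γ _ => mul_comm _ _)
    rw [s1, s2, s3]
    ring
  have e2 : ∑ μ, ∑ ν, ∑ γ, ∑ δ,
      h.chernCurvature e μ ν γ δ z * W μ * star (W ν) * W γ * star (W δ)
      = -(L + ∑ γ, V γ * A' γ) := by
    have h3 := sum_curvature_expand
      (fun μ ν γ δ => wirtinger μ (wirtingerBar ν (fun w => h.coeff e w γ δ)) z)
      (fun α β => h.coeffInv e α β z) (fun μ γ β => wirtinger μ (fun w => h.coeff e w γ β) z)
      (fun ν α δ => wirtingerBar ν (fun w => h.coeff e w α δ) z) (fun μ => W μ)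
      (fun μ => star (W μ))
    have h4 : ∑ α, ∑ β, h.coeffInv e α β z * A β * A' α = -∑ γ, V γ * A' γ := by
      rw [← Finset.sum_neg_distrib]
      refine Finset.sum_congr rfl fun α _ => ?_
      rw [hVα, neg_mul, neg_neg, Finset.sum_mul]
      exact Finset.sum_congr rfl fun β _ => by rw [coeffInv, mul_comm (A β)]
    rw [neg_add, ← h4]
    exact h3
  rw [e1, e2, Complex.neg_re, neg_mul_neg, ← Complex.re_ofReal_mul]
  norm_num

end HermitianCoefficients

/-! ### Real structures underlying complex manifolds -/

section RealStructure

variable {m : ℕ} {M : Type*} [TopologicalSpace M] [ChartedSpace (EuclideanSpace ℂ (Fin m)) M]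

theorem isManifold_real [IsManifold 𝓘(ℂ, EuclideanSpace ℂ (Fin m)) ω M] :
    IsManifold 𝓘(ℝ, EuclideanSpace ℂ (Fin m)) ∞ M := by
  refine isManifold_of_contDiffOn _ _ _ fun e e' he he' => ?_
  have h : ContDiffOn ℂ ω (e.symm.trans e') (e.symm.trans e').source := by
    have := (contDiffGroupoid ω 𝓘(ℂ, EuclideanSpace ℂ (Fin m))).compatible he he'
    rw [contDiffGroupoid, mem_groupoid_of_pregroupoid] at this
    simpa [contDiffPregroupoid] using this.1
  simpa using (h.restrict_scalars ℝ).of_le (m := ∞) (by simp)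

/-- A complex derivative is also a real derivative after restriction of scalars. This links the
Hermitian metric, defined by holomorphic charts, to the real differential of a smooth map. -/
theorem holoVec_eq_mfderiv_real [IsManifold 𝓘(ℂ, EuclideanSpace ℂ (Fin m)) ω M]
    {e : OpenPartialHomeomorph M (EuclideanSpace ℂ (Fin m))} (he : e ∈ holoCharts m M)
    {z : EuclideanSpace ℂ (Fin m)} (hz : z ∈ e.target) :
    MDifferentiableAt 𝓘(ℝ, EuclideanSpace ℂ (Fin m)) 𝓘(ℝ, EuclideanSpace ℂ (Fin m)) e.symm z ∧
    ∀ w : EuclideanSpace ℂ (Fin m),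
      mfderiv 𝓘(ℝ, EuclideanSpace ℂ (Fin m)) 𝓘(ℝ, EuclideanSpace ℂ (Fin m)) e.symm z w
        = holoVec e z w := by
  have h := ((holoCharts_mdifferentiable he).mdifferentiableAt_symm hz).hasMFDerivAt
  let D : EuclideanSpace ℂ (Fin m) →L[ℂ] EuclideanSpace ℂ (Fin m) :=
    mfderiv 𝓘(ℂ, EuclideanSpace ℂ (Fin m)) 𝓘(ℂ, EuclideanSpace ℂ (Fin m)) e.symm z
  have h' : HasMFDerivAt 𝓘(ℝ, EuclideanSpace ℂ (Fin m)) 𝓘(ℝ, EuclideanSpace ℂ (Fin m)) e.symm z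
      (D.restrictScalars ℝ) :=
    ⟨h.1, h.2.restrictScalars ℝ⟩
  refine ⟨h'.mdifferentiableAt, fun w => ?_⟩
  rw [h'.mfderiv]
  rfl

end RealStructure

/-! ### The coordinate expression of a smooth map -/

section CoordinateMap

set_option linter.unusedSectionVars false

variable {m : ℕ} {M : Type*} [TopologicalSpace M] [ChartedSpace (EuclideanSpace ℂ (Fin m)) M]
  {F : Type*} [NormedAddCommGroup F] [NormedSpace ℝ F]
  {N : Type*} [TopologicalSpace N] [ChartedSpace F N]

/-- The domain of the coordinate expression of `f`. -/
def coordDomain (f : M → N) (φ : OpenPartialHomeomorph M (EuclideanSpace ℂ (Fin m)))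
    (ψ : OpenPartialHomeomorph N F) : Set (EuclideanSpace ℂ (Fin m)) :=
  φ.target ∩ (fun z => f (φ.symm z)) ⁻¹' ψ.source

theorem isOpen_coordDomain {f : M → N} (hf : Continuous f)
    (φ : OpenPartialHomeomorph M (EuclideanSpace ℂ (Fin m))) (ψ : OpenPartialHomeomorph N F) :
    IsOpen (coordDomain f φ ψ) :=
  (hf.comp_continuousOn φ.continuousOn_symm).isOpen_inter_preimage φ.open_target ψ.open_source

variable [IsManifold 𝓘(ℂ, EuclideanSpace ℂ (Fin m)) ω M] [IsManifold 𝓘(ℝ, F) ∞ N]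

theorem contDiffOn_coordMap {f : M → N}
    (hf : ContMDiff 𝓘(ℝ, EuclideanSpace ℂ (Fin m)) 𝓘(ℝ, F) ∞ f) (x : M) (y : N) :
    ContDiffOn ℝ ∞ (fun z => chartAt F y (f ((chartAt (EuclideanSpace ℂ (Fin m)) x).symm z)))
      (coordDomain f (chartAt (EuclideanSpace ℂ (Fin m)) x) (chartAt F y)) := by
  have := isManifold_real (m := m) (M := M)
  rw [← contMDiffOn_iff_contDiffOn]
  have h1 := contMDiffOn_symm_of_mem_maximalAtlas (n := ∞)
    (IsManifold.chart_mem_maximalAtlas (I := 𝓘(ℝ, EuclideanSpace ℂ (Fin m))) (n := ∞) x)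
  have h2 := contMDiffOn_of_mem_maximalAtlas (n := ∞)
    (IsManifold.chart_mem_maximalAtlas (I := 𝓘(ℝ, F)) (n := ∞) y)
  exact h2.comp ((hf.comp_contMDiffOn h1).mono Set.inter_subset_left) fun z hz => hz.2

/-- The chain rule applied to both sides of f ∘ φ⁻¹ = ψ⁻¹ ∘ u near `z`, where u is the coordinate
expression of `f`. -/
theorem mfderiv_holoVec {f : M → N}
    (hf : ContMDiff 𝓘(ℝ, EuclideanSpace ℂ (Fin m)) 𝓘(ℝ, F) ∞ f) (x : M) (y : N)
    {z : EuclideanSpace ℂ (Fin m)}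
    (hz : z ∈ coordDomain f (chartAt (EuclideanSpace ℂ (Fin m)) x) (chartAt F y))
    (w : EuclideanSpace ℂ (Fin m)) :
    (mfderiv 𝓘(ℝ, EuclideanSpace ℂ (Fin m)) 𝓘(ℝ, F) f
        ((chartAt (EuclideanSpace ℂ (Fin m)) x).symm z)
        (holoVec (chartAt (EuclideanSpace ℂ (Fin m)) x) z w) : F)
      = mfderiv 𝓘(ℝ, F) 𝓘(ℝ, F) (chartAt F y).symm
          (chartAt F y (f ((chartAt (EuclideanSpace ℂ (Fin m)) x).symm z)))
          (fderiv ℝ (fun z => chartAt F y (f ((chartAt (EuclideanSpace ℂ (Fin m)) x).symm z)))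
            z w) := by
  set φ := chartAt (EuclideanSpace ℂ (Fin m)) x
  set ψ := chartAt F y
  have hO := isOpen_coordDomain hf.continuous φ ψ
  obtain ⟨hφd, hφ⟩ := holoVec_eq_mfderiv_real
    (IsManifold.chart_mem_maximalAtlas (I := 𝓘(ℂ, EuclideanSpace ℂ (Fin m))) (n := ω) x) hz.1
  have hu : DifferentiableAt ℝ (fun z => ψ (f (φ.symm z))) z :=
    ((contDiffOn_coordMap hf x y).contDiffAt (hO.mem_nhds hz)).differentiableAt (by simp)
  have hψ : MDifferentiableAt 𝓘(ℝ, F) 𝓘(ℝ, F) ψ.symm (ψ (f (φ.symm z))) :=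
    mdifferentiableAt_atlas_symm (I := 𝓘(ℝ, F)) (chart_mem_atlas F y)
      (ψ.map_source hz.2)
  have hff : MDifferentiableAt 𝓘(ℝ, EuclideanSpace ℂ (Fin m)) 𝓘(ℝ, F) f (φ.symm z) :=
    (hf _).mdifferentiableAt (by simp)
  have e : f ∘ φ.symm =ᶠ[nhds z] ψ.symm ∘ fun z => ψ (f (φ.symm z)) := by
    filter_upwards [hO.mem_nhds hz] with s hs
    exact (ψ.left_inv hs.2).symm
  have h1 := mfderiv_comp z hff hφd
  have h2 := mfderiv_comp z hψ hu.mdifferentiableAt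
  rw [e.mfderiv_eq, h2, mfderiv_eq_fderiv] at h1
  rw [← hφ w]
  exact (congrArg (fun L => L w) h1).symm

end CoordinateMap

/-! ### The maximum principle for the energy of a pluri-harmonic map -/

section MaximumPrinciple

set_option linter.unusedSectionVars false

variable {m : ℕ} {M : Type*} [TopologicalSpace M] [ChartedSpace (EuclideanSpace ℂ (Fin m)) M]
  {F : Type*} [NormedAddCommGroup F] [NormedSpace ℝ F]
  {N : Type*} [TopologicalSpace N] [ChartedSpace F N]

/-- The energy of `f` in the complex direction `W`, for the quadratic forms `γ` on the target. -/
noncomputable def dirEnergy (γ : N → F → ℝ) (f : M → N) (x : M) (W : EuclideanSpace ℂ (Fin m)) :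
    ℝ :=
  γ (f x) (mfderiv 𝓘(ℝ, EuclideanSpace ℂ (Fin m)) 𝓘(ℝ, F) f x W)
    + γ (f x) (mfderiv 𝓘(ℝ, EuclideanSpace ℂ (Fin m)) 𝓘(ℝ, F) f x (Complex.I • W))

/-- The coordinate expression of `f` in the preferred charts at `x` and `f x`. -/
noncomputable def coordMap (f : M → N) (x : M) (z : EuclideanSpace ℂ (Fin m)) : F :=
  chartAt F (f x) (f ((chartAt (EuclideanSpace ℂ (Fin m)) x).symm z))

/-- The coordinate expression of the energy. -/
noncomputable def coordEnergy (g : F → F →L[ℝ] F →L[ℝ] ℝ) (f : M → N) (x : M)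
    (z w : EuclideanSpace ℂ (Fin m)) : ℝ :=
  g (coordMap f x z) (fderiv ℝ (coordMap f x) z w) (fderiv ℝ (coordMap f x) z w)
    + g (coordMap f x z) (fderiv ℝ (coordMap f x) z (Complex.I • w))
      (fderiv ℝ (coordMap f x) z (Complex.I • w))

/-- The domain of the coordinate expression of `f` at `x`. -/
def preferredDomain (m : ℕ) {M : Type*} [TopologicalSpace M]
    [ChartedSpace (EuclideanSpace ℂ (Fin m)) M] (F : Type*) [NormedAddCommGroup F]
    {N : Type*} [TopologicalSpace N] [ChartedSpace F N] (f : M → N) (x : M) : Set (EuclideanSpace ℂ (Fin m)) :=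
  coordDomain f (chartAt (EuclideanSpace ℂ (Fin m)) x) (chartAt F (f x))

/-- The metric `g` with connection `Γ` on the domain of `ψ` represents the quadratic forms `γ`. -/
structure RepresentsMetric (γ : N → F → ℝ) (ψ : OpenPartialHomeomorph N F)
    (g : F → F →L[ℝ] F →L[ℝ] ℝ) (Γ : F → F →L[ℝ] F →L[ℝ] F) : Prop where
  nonpos : IsNonposCoordMetric ψ.target g Γ
  eq : ∀ y ∈ ψ.target, ∀ v, γ (ψ.symm y) (mfderiv 𝓘(ℝ, F) 𝓘(ℝ, F) ψ.symm y v) = g y v v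

theorem coordEnergy_smul (g : F → F →L[ℝ] F →L[ℝ] ℝ) (f : M → N) (x : M)
    (z w : EuclideanSpace ℂ (Fin m)) (c : ℝ) :
    coordEnergy g f x z (c • w) = c ^ 2 * coordEnergy g f x z w := by
  simp only [coordEnergy, smul_comm Complex.I c w, map_smul, smul_apply, smul_eq_mul]
  ring

variable [IsManifold 𝓘(ℂ, EuclideanSpace ℂ (Fin m)) ω M] [IsManifold 𝓘(ℝ, F) ∞ N]
  {f : M → N} {γ : N → F → ℝ} {g : F → F →L[ℝ] F →L[ℝ] ℝ} {Γ : F → F →L[ℝ] F →L[ℝ] F} {x : M}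

theorem chart_mem_holoCharts (x : M) : chartAt (EuclideanSpace ℂ (Fin m)) x ∈ holoCharts m M :=
  IsManifold.chart_mem_maximalAtlas x

/-- Passes between the intrinsic energy, which can be compared across charts when maximizing, and
its smooth coordinate expression, which can be differentiated. -/
theorem dirEnergy_holoVec (hf : ContMDiff 𝓘(ℝ, EuclideanSpace ℂ (Fin m)) 𝓘(ℝ, F) ∞ f)
    (hg : RepresentsMetric γ (chartAt F (f x)) g Γ) {z : EuclideanSpace ℂ (Fin m)}
    (hz : z ∈ preferredDomain m F f x) (w : EuclideanSpace ℂ (Fin m)) :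
    dirEnergy γ f ((chartAt (EuclideanSpace ℂ (Fin m)) x).symm z)
      (holoVec (chartAt (EuclideanSpace ℂ (Fin m)) x) z w) = coordEnergy g f x z w := by
  have ht := (chartAt F (f x)).map_source hz.2
  have hl := (chartAt F (f x)).left_inv hz.2
  have e : ∀ w, γ (f ((chartAt (EuclideanSpace ℂ (Fin m)) x).symm z))
      (mfderiv 𝓘(ℝ, EuclideanSpace ℂ (Fin m)) 𝓘(ℝ, F) f
        ((chartAt (EuclideanSpace ℂ (Fin m)) x).symm z)
        (holoVec (chartAt (EuclideanSpace ℂ (Fin m)) x) z w))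
      = g (coordMap f x z) (fderiv ℝ (coordMap f x) z w) (fderiv ℝ (coordMap f x) z w) := by
    intro w
    have h := hg.eq _ ht (fderiv ℝ (coordMap f x : EuclideanSpace ℂ (Fin m) → F) z w)
    rw [hl] at h
    exact (congrArg (γ _) (mfderiv_holoVec hf x (f x) hz w)).trans h
  have h2 := e (Complex.I • w)
  rw [holoVec_smul] at h2
  exact congrArg₂ (· + ·) (e w) h2

theorem isOpen_preferredDomain
    (hf : ContMDiff 𝓘(ℝ, EuclideanSpace ℂ (Fin m)) 𝓘(ℝ, F) ∞ f) (x : M) :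
    IsOpen (preferredDomain m F f x) :=
  isOpen_coordDomain hf.continuous _ _

theorem center_mem_preferredDomain (f : M → N) (x : M) :
    chartAt (EuclideanSpace ℂ (Fin m)) x x ∈ preferredDomain m F f x := by
  refine ⟨mem_chart_target _ x, ?_⟩
  simp [(chartAt (EuclideanSpace ℂ (Fin m)) x).left_inv (mem_chart_source _ x)]

theorem contDiffOn_coordMap_preferred
    (hf : ContMDiff 𝓘(ℝ, EuclideanSpace ℂ (Fin m)) 𝓘(ℝ, F) ∞ f) (x : M) :
    ContDiffOn ℝ ∞ (coordMap f x : EuclideanSpace ℂ (Fin m) → F) (preferredDomain m F f x) :=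
  contDiffOn_coordMap hf x (f x)

theorem mapsTo_coordMap (f : M → N) (x : M) :
    Set.MapsTo (coordMap f x : EuclideanSpace ℂ (Fin m) → F) (preferredDomain m F f x) (chartAt F (f x)).target :=
  fun _ hz => (chartAt F (f x)).map_source hz.2

theorem continuousOn_coordEnergy (hf : ContMDiff 𝓘(ℝ, EuclideanSpace ℂ (Fin m)) 𝓘(ℝ, F) ∞ f)
    (hg : RepresentsMetric γ (chartAt F (f x)) g Γ) :
    ContinuousOn (fun p : EuclideanSpace ℂ (Fin m) × EuclideanSpace ℂ (Fin m) =>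
      coordEnergy g f x p.1 p.2) (preferredDomain m F f x ×ˢ Set.univ) := by
  have h1 : ContinuousOn (fun p : EuclideanSpace ℂ (Fin m) × EuclideanSpace ℂ (Fin m) =>
      g (coordMap f x p.1)) (preferredDomain m F f x ×ˢ Set.univ) :=
    (hg.nonpos.contDiffOn_metric.continuousOn.comp
      (contDiffOn_coordMap_preferred hf x).continuousOn (mapsTo_coordMap f x)).comp
      continuousOn_fst fun p hp => hp.1
  have h2 : ContinuousOn (fun p : EuclideanSpace ℂ (Fin m) × EuclideanSpace ℂ (Fin m) =>
      fderiv ℝ (coordMap f x : EuclideanSpace ℂ (Fin m) → F) p.1) (preferredDomain m F f x ×ˢ Set.univ) :=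
    ((contDiffOn_coordMap_preferred hf x).continuousOn_fderiv_of_isOpen
      (isOpen_preferredDomain hf x) (by simp)).comp continuousOn_fst fun p hp => hp.1
  have h3 := h2.clm_apply (continuousOn_snd (s := preferredDomain m F f x ×ˢ Set.univ))
  have h4 := h2.clm_apply
    ((continuousOn_snd (s := preferredDomain m F f x ×ˢ Set.univ)).const_smul Complex.I)
  exact ((h1.clm_apply h3).clm_apply h3).add ((h1.clm_apply h4).clm_apply h4)

/-- In a chart the quotient is continuous on the product of a closed ball and the unit sphere, which
is compact. Both numerator and denominator scale by c² under real c, so the bound extends to all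
nonzero vectors. -/
theorem exists_local_maximizer [Nontrivial (EuclideanSpace ℂ (Fin m))]
    (h : HermitianMetric m M)
    (hf : ContMDiff 𝓘(ℝ, EuclideanSpace ℂ (Fin m)) 𝓘(ℝ, F) ∞ f)
    (hg : RepresentsMetric γ (chartAt F (f x)) g Γ) :
    ∃ U ∈ nhds x, ∃ (x₁ : M) (W₁ : EuclideanSpace ℂ (Fin m)), W₁ ≠ 0 ∧
      ∀ y ∈ U, ∀ W : EuclideanSpace ℂ (Fin m), W ≠ 0 →
        dirEnergy γ f y W / (h.inner y W W).re ≤ dirEnergy γ f x₁ W₁ / (h.inner x₁ W₁ W₁).re := by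
  set φ := chartAt (EuclideanSpace ℂ (Fin m)) x with hφ
  have he : φ ∈ holoCharts m M := chart_mem_holoCharts x
  set D := preferredDomain m F f x with hD
  obtain ⟨r, hr, hball⟩ := Metric.nhds_basis_closedBall.mem_iff.mp
    ((isOpen_preferredDomain hf x).mem_nhds (center_mem_preferredDomain f x))
  set K := Metric.closedBall (φ x) r ×ˢ Metric.sphere (0 : EuclideanSpace ℂ (Fin m)) 1
  have hK : IsCompact K := (isCompact_closedBall _ _).prod (isCompact_sphere _ _)
  have hKne : K.Nonempty :=
    (Metric.nonempty_closedBall.mpr hr.le).prod (NormedSpace.sphere_nonempty.mpr zero_le_one)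
  set n : EuclideanSpace ℂ (Fin m) → EuclideanSpace ℂ (Fin m) → ℝ := fun z w =>
    (∑ α, ∑ β, h.coeff φ z α β * w α * star (w β)).re with hn
  have hnpos : ∀ z ∈ D, ∀ w, w ≠ 0 → 0 < n z w := fun z hz w hw => h.coeff_pos he hz.1 hw
  have hne : ∀ z w, (h.inner (φ.symm z) (holoVec φ z w) (holoVec φ z w)).re = n z w :=
    fun z w => by rw [h.inner_holoVec]
  have hnsmul : ∀ z w (c : ℝ), n z (c • w) = c ^ 2 * n z w := by
    intro z w c
    simp only [hn]
    rw [← Complex.re_ofReal_mul, Finset.mul_sum]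
    refine congrArg Complex.re ?_
    refine Finset.sum_congr rfl fun α _ => ?_
    rw [Finset.mul_sum]
    refine Finset.sum_congr rfl fun β _ => ?_
    simp
    ring
  have hKD : ∀ p ∈ K, p.1 ∈ D ∧ p.2 ≠ 0 := fun p hp =>
    ⟨hball hp.1, fun h0 => by simpa [h0] using hp.2⟩
  have hncont : ContinuousOn (fun p : EuclideanSpace ℂ (Fin m) × EuclideanSpace ℂ (Fin m) =>
      n p.1 p.2) K := by
    refine Complex.continuous_re.comp_continuousOn
      (continuousOn_finsetSum _ fun α _ => continuousOn_finsetSum _ fun β _ => ?_)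
    have h1 : ContinuousOn (fun p : EuclideanSpace ℂ (Fin m) × EuclideanSpace ℂ (Fin m) =>
        h.coeff φ p.1 α β) K :=
      (h.contDiffOn_coeff he α β).continuousOn.comp continuousOn_fst fun p hp => (hKD p hp).1.1
    have h2 : Continuous (fun p : EuclideanSpace ℂ (Fin m) × EuclideanSpace ℂ (Fin m) =>
        p.2 α) := by fun_prop
    have h3 : Continuous (fun p : EuclideanSpace ℂ (Fin m) × EuclideanSpace ℂ (Fin m) =>
        star (p.2 β)) := continuous_star.comp (by fun_prop)
    exact (h1.mul h2.continuousOn).mul h3.continuousOn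
  have hcont : ContinuousOn (fun p : EuclideanSpace ℂ (Fin m) × EuclideanSpace ℂ (Fin m) =>
      coordEnergy g f x p.1 p.2 / n p.1 p.2) K :=
    ((continuousOn_coordEnergy hf hg).mono fun p hp => ⟨(hKD p hp).1, trivial⟩).div hncont
      fun p hp => (hnpos _ (hKD p hp).1 _ (hKD p hp).2).ne'
  obtain ⟨p, hp, hmax⟩ := hK.exists_isMaxOn hKne hcont
  refine ⟨φ.source ∩ φ ⁻¹' Metric.ball (φ x) r, ?_, φ.symm p.1, holoVec φ p.1 p.2,
    holoVec_ne_zero he (hKD p hp).1.1 (hKD p hp).2, ?_⟩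
  · exact (φ.continuousOn.isOpen_inter_preimage φ.open_source Metric.isOpen_ball).mem_nhds
      ⟨mem_chart_source _ x, Metric.mem_ball_self hr⟩
  · rintro y ⟨hy, hyr⟩ W hW
    have hyD : φ y ∈ D := hball (Metric.ball_subset_closedBall hyr)
    obtain ⟨w, hw⟩ : ∃ w, holoVec φ (φ y) w = W := (holoVec_bijective he hyD.1).2 W
    have hw0 : w ≠ 0 := by
      rintro rfl
      exact hW (hw.symm.trans (holoVec_zero _))
    have hwn : ‖w‖ ≠ 0 := norm_ne_zero_iff.mpr hw0
    have hm := hmax (show (φ y, ‖w‖⁻¹ • w) ∈ K from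
      ⟨Metric.ball_subset_closedBall hyr, by simp [norm_smul, hwn]⟩)
    simp only [Set.mem_ofPred_eq, coordEnergy_smul, hnsmul] at hm
    rw [mul_div_mul_left _ _ (pow_ne_zero 2 (inv_ne_zero hwn))] at hm
    have e1 : dirEnergy γ f y W / (h.inner y W W).re
        = coordEnergy g f x (φ y) w / n (φ y) w := by
      rw [← dirEnergy_holoVec hf hg hyD w, ← hne, ← hφ, hw, φ.left_inv hy]
    rw [e1, hne, dirEnergy_holoVec hf hg (hKD p hp).1]
    exact hm

theorem exists_maximizer [Nontrivial (EuclideanSpace ℂ (Fin m))] [CompactSpace M] [Nonempty M]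
    (h : HermitianMetric m M)
    (hf : ContMDiff 𝓘(ℝ, EuclideanSpace ℂ (Fin m)) 𝓘(ℝ, F) ∞ f)
    (hg : ∀ x, ∃ g Γ, RepresentsMetric γ (chartAt F (f x)) g Γ) :
    ∃ (x₁ : M) (W₁ : EuclideanSpace ℂ (Fin m)), W₁ ≠ 0 ∧
      ∀ y, ∀ W : EuclideanSpace ℂ (Fin m), W ≠ 0 →
        dirEnergy γ f y W / (h.inner y W W).re ≤ dirEnergy γ f x₁ W₁ / (h.inner x₁ W₁ W₁).re := by
  obtain ⟨w₀, hw₀⟩ := exists_ne (0 : EuclideanSpace ℂ (Fin m))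
  -- Compactness of `M` replaces that of the projectivized tangent bundle. The maximizing pair need
  -- not lie over the set `S`, so the property passes to subsets, and a union keeps the larger of
  -- two bounds.
  have key := isCompact_univ (X := M).induction_on (p := fun S => ∃ (x₁ : M)
    (W₁ : EuclideanSpace ℂ (Fin m)), W₁ ≠ 0 ∧ ∀ y ∈ S, ∀ W : EuclideanSpace ℂ (Fin m), W ≠ 0 →
      dirEnergy γ f y W / (h.inner y W W).re ≤ dirEnergy γ f x₁ W₁ / (h.inner x₁ W₁ W₁).re)
    ⟨Classical.arbitrary M, w₀, hw₀, by simp⟩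
    (fun S T hST ⟨x₁, W₁, h0, hT⟩ => ⟨x₁, W₁, h0, fun y hy => hT y (hST hy)⟩)
    (by
      rintro S T ⟨x₁, W₁, h1, hS⟩ ⟨x₂, W₂, h2, hT⟩
      rcases le_total (dirEnergy γ f x₁ W₁ / (h.inner x₁ W₁ W₁).re)
        (dirEnergy γ f x₂ W₂ / (h.inner x₂ W₂ W₂).re) with hle | hle
      · exact ⟨x₂, W₂, h2, fun y hy W hW =>
          hy.elim (fun hy => (hS y hy W hW).trans hle) (fun hy => hT y hy W hW)⟩
      · exact ⟨x₁, W₁, h1, fun y hy W hW =>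
          hy.elim (fun hy => hS y hy W hW) (fun hy => (hT y hy W hW).trans hle)⟩)
    (by
      intro x _
      obtain ⟨g, Γ, hgx⟩ := hg x
      obtain ⟨U, hU, x₁, W₁, h1, h2⟩ := exists_local_maximizer (x := x) h hf hgx
      exact ⟨U, mem_nhdsWithin_of_mem_nhds hU, x₁, W₁, h1, h2⟩)
  obtain ⟨x₁, W₁, h1, h2⟩ := key
  exact ⟨x₁, W₁, h1, fun y => h2 y trivial⟩

end MaximumPrinciple

/-! ### Vanishing of the maximal energy and constancy of the map -/

section Vanishing

set_option linter.unusedSectionVars false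

variable {m : ℕ} {M : Type*} [TopologicalSpace M] [ChartedSpace (EuclideanSpace ℂ (Fin m)) M]
  {F : Type*} [NormedAddCommGroup F] [NormedSpace ℝ F]
  {N : Type*} [TopologicalSpace N] [ChartedSpace F N]

theorem secondDirDeriv_add {E G : Type*} [NormedAddCommGroup E] [NormedSpace ℝ E]
    [NormedAddCommGroup G] [NormedSpace ℝ G] {Φ Ψ : E → G} {t : E} (hΦ : ContDiffAt ℝ 2 Φ t)
    (hΨ : ContDiffAt ℝ 2 Ψ t) (a : E) :
    secondDirDeriv (fun s => Φ s + Ψ s) a t = secondDirDeriv Φ a t + secondDirDeriv Ψ a t := by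
  have e : (fun s => fderiv ℝ (fun s => Φ s + Ψ s) s a)
      =ᶠ[nhds t] fun s => fderiv ℝ Φ s a + fderiv ℝ Ψ s a := by
    filter_upwards [hΦ.eventually (by simp), hΨ.eventually (by simp)] with s h1 h2
    rw [fderiv_fun_add (h1.differentiableAt (by norm_num)) (h2.differentiableAt (by norm_num)),
      add_apply]
  rw [secondDirDeriv, e.fderiv_eq, fderiv_fun_add (hΦ.differentiableAt_fderiv_apply a)
    (hΨ.differentiableAt_fderiv_apply a), add_apply]
  rfl

/-- The pluri-harmonic map equation of `f` in the preferred charts at `x`, in real terms. -/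
def IsPluriHarmonicAt (Γ : F → F →L[ℝ] F →L[ℝ] F) (f : M → N) (x : M) : Prop :=
  ∀ z ∈ preferredDomain m F f x, ∀ w : EuclideanSpace ℂ (Fin m),
    fderiv ℝ (fderiv ℝ (coordMap f x : EuclideanSpace ℂ (Fin m) → F)) z w w
      + fderiv ℝ (fderiv ℝ (coordMap f x)) z (Complex.I • w) (Complex.I • w)
      + (Γ (coordMap f x z) (fderiv ℝ (coordMap f x) z w) (fderiv ℝ (coordMap f x) z w)
        + Γ (coordMap f x z) (fderiv ℝ (coordMap f x) z (Complex.I • w))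
          (fderiv ℝ (coordMap f x) z (Complex.I • w))) = 0

variable [IsManifold 𝓘(ℂ, EuclideanSpace ℂ (Fin m)) ω M] [IsManifold 𝓘(ℝ, F) ∞ N]
  {f : M → N} {γ : N → F → ℝ} {g : F → F →L[ℝ] F →L[ℝ] ℝ} {Γ : F → F →L[ℝ] F →L[ℝ] F} {x : M}

/-- The core of the argument. If the maximum were positive, the disc adapted to the maximizing
direction would force the Laplacian of the energy to be negative at its centre, against the Bochner
inequality. -/
theorem dirEnergy_nonpos_of_maximizer (h : HermitianMetric m M) (hpos : h.HasPositiveHSC)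
    (hf : ContMDiff 𝓘(ℝ, EuclideanSpace ℂ (Fin m)) 𝓘(ℝ, F) ∞ f)
    (hg : RepresentsMetric γ (chartAt F (f x)) g Γ) (hharm : IsPluriHarmonicAt (m := m) Γ f x)
    {W₁ : EuclideanSpace ℂ (Fin m)} (hW₁ : W₁ ≠ 0)
    (hmax : ∀ y, ∀ W : EuclideanSpace ℂ (Fin m), W ≠ 0 →
      dirEnergy γ f y W / (h.inner y W W).re ≤ dirEnergy γ f x W₁ / (h.inner x W₁ W₁).re) :
    dirEnergy γ f x W₁ / (h.inner x W₁ W₁).re ≤ 0 := by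
  by_contra! hQ
  set Q := dirEnergy γ f x W₁ / (h.inner x W₁ W₁).re with hQdef
  set φ := chartAt (EuclideanSpace ℂ (Fin m)) x with hφ
  have he : φ ∈ holoCharts m M := chart_mem_holoCharts x
  set D := preferredDomain m F f x with hD
  have hDo : IsOpen D := isOpen_preferredDomain hf x
  have hzD : φ x ∈ D := center_mem_preferredDomain f x
  have hφx : φ.symm (φ x) = x := φ.left_inv (mem_chart_source _ x)
  obtain ⟨w₁, hw⟩ : ∃ w, holoVec φ (φ x) w = W₁ := (holoVec_bijective he hzD.1).2 W₁
  have hw0 : w₁ ≠ 0 := by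
    rintro rfl
    exact hW₁ (hw.symm.trans (holoVec_zero _))
  obtain ⟨V, hV⟩ := h.exists_disc_laplacian he hzD.1 w₁
  set c := disc (φ x) w₁ V with hc
  have hcs : ContDiff ℝ ∞ c := contDiff_disc _ _ _
  have hc0 : c 0 = φ x := disc_zero _ _ _
  set U := c ⁻¹' D with hU
  have hUo : IsOpen U := hDo.preimage hcs.continuous
  have h0U : (0 : ℂ) ∈ U := by simpa [hU, hc0] using hzD
  set u : ℂ → F := fun t => coordMap f x (c t) with hu
  have hL := contDiffOn_coordMap_preferred hf x
  have hus : ContDiffOn ℝ ∞ u U := hL.comp hcs.contDiffOn fun t ht => ht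
  have hLd : ∀ t ∈ U, ContDiffAt ℝ 2 (coordMap f x : EuclideanSpace ℂ (Fin m) → F) (c t) :=
    fun t ht => (hL.contDiffAt (hDo.mem_nhds ht)).of_le (by norm_cast)
  have hu' : ∀ t ∈ U, ∀ a, fderiv ℝ u t a = fderiv ℝ (coordMap f x) (c t) (a • (w₁ + t • V)) :=
    fun t ht a => fderiv_comp_disc ((hLd t ht).differentiableAt (by norm_num)) a
  have hUT : Set.MapsTo u U (chartAt F (f x)).target := fun t ht => mapsTo_coordMap f x ht
  set e₁ : ℂ → ℝ := fun s => g (u s) (fderiv ℝ u s 1) (fderiv ℝ u s 1) with he₁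
  set e₂ : ℂ → ℝ := fun s => g (u s) (fderiv ℝ u s Complex.I) (fderiv ℝ u s Complex.I) with he₂
  set H : ℂ → ℝ := fun t => (∑ α, ∑ β, h.coeff φ (c t) α β * (w₁ + t • V) α
    * star ((w₁ + t • V) β)).re with hH
  have hes : ∀ t ∈ U, e₁ t + e₂ t = coordEnergy g f x (c t) (w₁ + t • V) := by
    intro t ht
    change g (u t) (fderiv ℝ u t 1) (fderiv ℝ u t 1)
      + g (u t) (fderiv ℝ u t Complex.I) (fderiv ℝ u t Complex.I) = _
    rw [hu' t ht, hu' t ht, one_smul]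
    rfl
  have hle : ∀ t ∈ U, e₁ t + e₂ t ≤ Q * H t := by
    intro t ht
    rw [hes t ht]
    -- Maximality says nothing about the zero vector, but where the velocity vanishes both sides are
    -- zero.
    by_cases hv : w₁ + t • V = 0
    · have hH0 : H t = 0 := by
        simp only [hH]
        rw [hv]
        simp
      rw [hv, hH0]
      simp [coordEnergy]
    · have h1 := hmax (φ.symm (c t)) (holoVec φ (c t) (w₁ + t • V))
        (holoVec_ne_zero he ht.1 hv)
      rw [dirEnergy_holoVec hf hg ht, h.inner_holoVec] at h1
      exact (div_le_iff₀ (h.coeff_pos he ht.1 hv)).mp h1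
  have heq : e₁ 0 + e₂ 0 = Q * H 0 := by
    have h1 : (h.inner x W₁ W₁).re = H 0 := by
      have := h.inner_holoVec (e := φ) (φ x) w₁ w₁
      rw [hφx, hw] at this
      simp only [hH]
      rw [this, hc0, zero_smul, add_zero]
    have h2 : dirEnergy γ f x W₁ = e₁ 0 + e₂ 0 := by
      have := dirEnergy_holoVec hf hg hzD w₁
      rw [← hφ, hφx, hw] at this
      rw [hes 0 h0U, this, hc0, zero_smul, add_zero]
    rw [hQdef, h1, h2, div_mul_cancel₀]
    rw [← h1]
    exact (h.pos x W₁ hW₁).ne'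
  have hgu : ContDiffOn ℝ ∞ (fun s => g (u s)) U :=
    hg.nonpos.contDiffOn_metric.comp hus hUT
  have hua : ∀ a : ℂ, ContDiffOn ℝ ∞ (fun s => fderiv ℝ u s a) U := fun a =>
    (hus.fderiv_of_isOpen hUo (m := ∞) (by simp)).clm_apply contDiffOn_const
  have hed : ∀ a : ℂ, ContDiffAt ℝ 2 (fun s => g (u s) (fderiv ℝ u s a) (fderiv ℝ u s a)) 0 :=
    fun a => ((((hgu.clm_apply (hua a)).clm_apply (hua a)).contDiffAt
      (hUo.mem_nhds h0U)).of_le (by norm_cast))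
  have hHd : ContDiffAt ℝ 2 H 0 := by
    refine Complex.reCLM.contDiff.contDiffAt.comp 0
      (ContDiffAt.sum fun α _ => ContDiffAt.sum fun β _ => ?_)
    have h1 : ContDiffAt ℝ 2 (fun t => h.coeff φ (c t) α β) 0 :=
      (((h.contDiffOn_coeff he α β).contDiffAt
        (φ.open_target.mem_nhds (show c 0 ∈ φ.target from h0U.1))).comp 0
        hcs.contDiffAt).of_le (by norm_cast)
    have h2 : ∀ α, ContDiff ℝ 2 fun t : ℂ => (w₁ + t • V) α := fun α => by
      simp only [PiLp.add_apply, PiLp.smul_apply, smul_eq_mul]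
      fun_prop
    exact (h1.mul (h2 α).contDiffAt).mul (Complex.conjCLE.contDiff.comp (h2 β)).contDiffAt
  -- Multiplication by `-Q` as a linear map, so that `e₁ + e₂ - Q * H`, which has a local maximum at
  -- 0, is differentiated by linearity.
  set L : ℝ →L[ℝ] ℝ := (-Q) • ContinuousLinearMap.id ℝ ℝ with hLdef
  have hLH : ContDiffAt ℝ 2 (fun t => L (H t)) 0 := L.contDiff.contDiffAt.comp 0 hHd
  have hΦd : ContDiffAt ℝ 2 (fun t => (e₁ t + e₂ t) + L (H t)) 0 :=
    ((hed 1).add (hed Complex.I)).add hLH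
  have hΦmax : IsLocalMax (fun t => (e₁ t + e₂ t) + L (H t)) 0 := by
    filter_upwards [hUo.mem_nhds h0U] with t ht
    have := hle t ht
    simp only [hLdef, smul_apply, ContinuousLinearMap.id_apply, smul_eq_mul]
    linarith
  have hsec : ∀ a : ℂ, secondDirDeriv e₁ a 0 + secondDirDeriv e₂ a 0
      - Q * secondDirDeriv H a 0 ≤ 0 := by
    intro a
    have h1 := hΦmax.secondDirDeriv_nonpos hΦd a
    rw [secondDirDeriv_add ((hed 1).add (hed Complex.I)) hLH,
      secondDirDeriv_add (hed 1) (hed Complex.I), secondDirDeriv_clm_comp L hHd] at h1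
    simp only [hLdef, smul_apply, ContinuousLinearMap.id_apply, smul_eq_mul] at h1
    linarith
  -- Harmonicity of the restriction at `s` is the pluri-harmonic equation in the direction w₁ + sV.
  -- The extra terms from the acceleration are V and i²V = -V under the differential, and cancel.
  have hpde : ∀ s ∈ U, covDerivAlong Γ u 1 (fun r => fderiv ℝ u r 1) s
      + covDerivAlong Γ u Complex.I (fun r => fderiv ℝ u r Complex.I) s = 0 := by
    intro s hs
    have h1 := hharm (c s) hs (w₁ + s • V)
    have h2 : ∀ a, fderiv ℝ (fun r => fderiv ℝ u r a) s a = _ := fun a =>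
      secondDirDeriv_comp_disc (hLd s hs) a
    have h3 : fderiv ℝ (coordMap f x : EuclideanSpace ℂ (Fin m) → F) (disc (φ x) w₁ V s)
        (Complex.I • Complex.I • V)
        = -fderiv ℝ (coordMap f x : EuclideanSpace ℂ (Fin m) → F) (disc (φ x) w₁ V s) V := by
      rw [smul_smul, Complex.I_mul_I, neg_smul, one_smul, map_neg]
    rw [covDerivAlong, covDerivAlong, h2, h2, hu' s hs, hu' s hs, h3]
    simp only [one_smul]
    rw [← h1]
    abel
  have hlap := energy_laplacian_nonneg hUo (chartAt F (f x)).open_target h0U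
    hg.nonpos.contDiffOn_metric hg.nonpos.contDiffOn_christoffel hus hUT hg.nonpos.symm
    (fun y hy v => by
      by_cases hv : v = 0
      · simp [hv]
      · exact (hg.nonpos.pos y hy v hv).le)
    hg.nonpos.torsion_free hg.nonpos.compat hg.nonpos.curvature_nonpos hpde
  have hR : 0 < (∑ μ, ∑ ν, ∑ γ, ∑ δ,
      h.chernCurvature φ μ ν γ δ (φ x) * w₁ μ * star (w₁ ν) * w₁ γ * star (w₁ δ)).re := by
    have h1 := hpos φ he (φ x) hzD.1 w₁ (by
      intro h0
      exact hw0 (by ext i; exact congrFun h0 i))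
    rw [HermitianMetric.holoSectionalCurvature] at h1
    by_contra! hn
    exact absurd h1 (not_lt.mpr (div_nonpos_of_nonpos_of_nonneg hn (sq_nonneg _)))
  -- Summing the two directions gives 0 ≤ Δe ≤ Q ΔH = -4 Q R, while Q and R are positive.
  have a1 := hsec 1
  have a2 := hsec Complex.I
  have a3 := mul_pos hQ hR
  have a4 := congrArg (Q * ·) hV
  simp only [mul_add] at a4
  linarith

/-- A pluri-harmonic map to a non-positively curved target is constant if the source is compact
and connected with positive holomorphic sectional curvature. -/
theorem constant_of_isPluriHarmonicAt [CompactSpace M] [ConnectedSpace M]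
    (h : HermitianMetric m M) (hpos : h.HasPositiveHSC)
    (hf : ContMDiff 𝓘(ℝ, EuclideanSpace ℂ (Fin m)) 𝓘(ℝ, F) ∞ f)
    (hg : ∀ x, ∃ g Γ, RepresentsMetric γ (chartAt F (f x)) g Γ ∧
      IsPluriHarmonicAt (m := m) Γ f x) :
    ∃ c, ∀ x, f x = c := by
  have hE : ∀ (y : M) (W : EuclideanSpace ℂ (Fin m)), W ≠ 0 → dirEnergy γ f y W ≤ 0 := by
    intro y W hW
    -- The vector `W` itself shows that the dimension is positive; in dimension zero the claim is
    -- vacuous.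
    have : Nontrivial (EuclideanSpace ℂ (Fin m)) := ⟨⟨W, 0, hW⟩⟩
    obtain ⟨x₁, W₁, h1, h2⟩ := exists_maximizer (γ := γ) h hf
      fun x => (hg x).imp fun g hg => hg.imp fun Γ hg => hg.1
    obtain ⟨g, Γ, hg1, hg2⟩ := hg x₁
    have h3 := (h2 y W hW).trans (dirEnergy_nonpos_of_maximizer h hpos hf hg1 hg2 h1 h2)
    by_contra! hn
    exact absurd h3 (not_le.mpr (div_pos hn (h.pos y W hW)))
  have hloc : IsLocallyConstant f := by
    rw [IsLocallyConstant.iff_eventually_eq]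
    intro x
    obtain ⟨g, Γ, hg1, -⟩ := hg x
    set φ := chartAt (EuclideanSpace ℂ (Fin m)) x with hφ
    have hDo : IsOpen (preferredDomain m F f x) := isOpen_preferredDomain hf x
    obtain ⟨r, hr, hball⟩ := Metric.isOpen_iff.mp hDo _ (center_mem_preferredDomain f x)
    -- The energy is a sum of two values of a positive definite form, so being non-positive forces
    -- the differential to vanish.
    have hd : ∀ z ∈ preferredDomain m F f x, fderiv ℝ (coordMap f x) z = (0 : _ →L[ℝ] F) := by
      intro z hz
      ext w
      by_contra hne
      rw [zero_apply] at hne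
      have hw : w ≠ 0 := by
        rintro rfl
        exact hne (map_zero _)
      have h1 := hE ((chartAt (EuclideanSpace ℂ (Fin m)) x).symm z) _
        (holoVec_ne_zero (chart_mem_holoCharts x) hz.1 hw)
      rw [dirEnergy_holoVec hf hg1 hz, coordEnergy] at h1
      have h2 := hg1.nonpos.pos _ (mapsTo_coordMap f x hz) _ hne
      have h3 : 0 ≤ g (coordMap f x z) (fderiv ℝ (coordMap f x) z (Complex.I • w))
          (fderiv ℝ (coordMap f x) z (Complex.I • w)) := by
        by_cases hv : fderiv ℝ (coordMap f x) z (Complex.I • w) = (0 : F)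
        · simp [hv]
        · exact (hg1.nonpos.pos _ (mapsTo_coordMap f x hz) _ hv).le
      linarith
    have hconst : ∀ z ∈ Metric.ball (φ x) r, coordMap f x z = (coordMap f x (φ x) : F) := by
      intro z hz
      refine (convex_ball (φ x) r).is_const_of_fderivWithin_eq_zero (𝕜 := ℝ)
        (((contDiffOn_coordMap_preferred hf x).differentiableOn (by simp)).mono hball) ?_ hz
        (Metric.mem_ball_self hr)
      intro y hy
      rw [fderivWithin_of_isOpen Metric.isOpen_ball hy, hd y (hball hy)]
    have hnhds : φ.source ∩ φ ⁻¹' Metric.ball (φ x) r ∈ nhds x :=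
      (φ.continuousOn.isOpen_inter_preimage φ.open_source Metric.isOpen_ball).mem_nhds
        ⟨mem_chart_source _ x, Metric.mem_ball_self hr⟩
    filter_upwards [hnhds] with y hy
    have h1 := hconst (φ y) hy.2
    have hyD := hball hy.2
    have hxD := center_mem_preferredDomain (m := m) (F := F) f x
    have h2 := (chartAt F (f x)).injOn hyD.2 hxD.2 h1
    change f (φ.symm (φ y)) = f (φ.symm (φ x)) at h2
    rwa [φ.left_inv hy.1, φ.left_inv (mem_chart_source _ x)] at h2
  obtain ⟨x₀⟩ := (inferInstance : Nonempty M)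
  exact ⟨f x₀, fun x => hloc.apply_eq_of_isPreconnected isPreconnected_univ trivial trivial⟩

end Vanishing

/-! ### From the Wirtinger form of the pluri-harmonic equation to its real form -/

section RealForm

variable {m : ℕ} {F : Type*} [NormedAddCommGroup F] [NormedSpace ℝ F] {ι : Type*} [Fintype ι]

theorem fderiv_fderiv_apply {E G : Type*} [NormedAddCommGroup E] [NormedSpace ℝ E]
    [NormedAddCommGroup G] [NormedSpace ℝ G] {Ψ : E → G} {z : E} (h : ContDiffAt ℝ 2 Ψ z)
    (v v' : E) : fderiv ℝ (fderiv ℝ Ψ) z v v' = fderiv ℝ (fun s => fderiv ℝ Ψ s v') z v := by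
  have hd : DifferentiableAt ℝ (fderiv ℝ Ψ) z :=
    (h.fderiv_right (m := 1) (by norm_num)).differentiableAt (by norm_num)
  rw [(hd.hasFDerivAt.clm_apply (hasFDerivAt_const v' z)).fderiv]
  simp

theorem fderiv_comp_clm_apply {E G G' : Type*} [NormedAddCommGroup E] [NormedSpace ℝ E]
    [NormedAddCommGroup G] [NormedSpace ℝ G] [NormedAddCommGroup G'] [NormedSpace ℝ G']
    (L : G →L[ℝ] G') {Φ : E → G} {z : E} (h : ContDiffAt ℝ 2 Φ z) :
    (∀ v, fderiv ℝ (fun s => L (Φ s)) z v = L (fderiv ℝ Φ z v)) ∧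
    ∀ v v', fderiv ℝ (fderiv ℝ (fun s => L (Φ s))) z v v' = L (fderiv ℝ (fderiv ℝ Φ) z v v') := by
  have h1 : ∀ s, ContDiffAt ℝ 2 Φ s → ∀ v, fderiv ℝ (fun s => L (Φ s)) s v = L (fderiv ℝ Φ s v) := by
    intro s hs v
    have : fderiv ℝ (fun s => L (Φ s)) s = _ :=
      (L.hasFDerivAt.comp s (hs.differentiableAt (by norm_num)).hasFDerivAt).fderiv
    rw [this]
    rfl
  refine ⟨h1 z h, fun v v' => ?_⟩
  have hLΦ : ContDiffAt ℝ 2 (fun s => L (Φ s)) z := L.contDiff.contDiffAt.comp z h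
  rw [fderiv_fderiv_apply hLΦ, fderiv_fderiv_apply h]
  have e2 : (fun s => fderiv ℝ (fun s => L (Φ s)) s v') =ᶠ[nhds z] fun s => L (fderiv ℝ Φ s v') := by
    filter_upwards [h.eventually (by simp)] with s hs using h1 s hs v'
  have h2 : fderiv ℝ (fun s => L (fderiv ℝ Φ s v')) z = _ :=
    (L.hasFDerivAt.comp z (h.differentiableAt_fderiv_apply v').hasFDerivAt).fderiv
  rw [e2.fderiv_eq, h2]
  rfl

/-- Contracts the indexed equations with w^α w'^β, later taken with w' conjugate to w. Only this
diagonal part of the pluri-harmonic equation is used. -/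
theorem sum_contract_bilinear {κ R : Type*} [Fintype κ] [CommRing R] (C : ι → ι → R)
    (p q : κ → ι → R) (A : κ → κ → R) (w w' : κ → R)
    (h : ∀ α β, A α β + ∑ j, ∑ k, C j k * q β j * p α k = 0) :
    (∑ α, ∑ β, A α β * w α * w' β)
      + ∑ j, ∑ k, C j k * (∑ β, w' β * q β j) * (∑ α, w α * p α k) = 0 := by
  have e : ∑ j, ∑ k, C j k * (∑ β, w' β * q β j) * (∑ α, w α * p α k)
      = ∑ α, ∑ β, (∑ j, ∑ k, C j k * q β j * p α k) * w α * w' β := by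
    calc ∑ j, ∑ k, C j k * (∑ β, w' β * q β j) * (∑ α, w α * p α k)
        = ∑ j, ∑ k, ∑ α, ∑ β, C j k * q β j * p α k * w α * w' β := by
          refine Finset.sum_congr rfl fun j _ => Finset.sum_congr rfl fun k _ => ?_
          rw [Finset.mul_sum]
          refine Finset.sum_congr rfl fun α _ => ?_
          rw [Finset.mul_sum, Finset.sum_mul]
          exact Finset.sum_congr rfl fun β _ => by ring
      _ = ∑ α, ∑ β, ∑ j, ∑ k, C j k * q β j * p α k * w α * w' β := by
          rw [Finset.sum_congr rfl fun j _ => Finset.sum_comm, Finset.sum_comm]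
          refine Finset.sum_congr rfl fun α _ => ?_
          rw [Finset.sum_congr rfl fun j _ => Finset.sum_comm, Finset.sum_comm]
      _ = _ := by
          refine Finset.sum_congr rfl fun α _ => Finset.sum_congr rfl fun β _ => ?_
          simp only [Finset.sum_mul]
  rw [e, ← Finset.sum_add_distrib]
  refine Finset.sum_eq_zero fun α _ => ?_
  rw [← Finset.sum_add_distrib]
  refine Finset.sum_eq_zero fun β _ => ?_
  rw [← add_mul, ← add_mul, h, zero_mul, zero_mul]

/-- The functionals `L` are the coordinates of the target viewed as complex-valued, so real and
complex targets are treated together. The Levi form carries a factor 1/4 and the first-order factors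
1/2 each, so multiplying by 4 clears all of them. -/
theorem real_form_of_wirtinger {Φ : EuclideanSpace ℂ (Fin m) → F} {z : EuclideanSpace ℂ (Fin m)}
    (hΦ : ContDiffAt ℝ 2 Φ z) (L : ι → F →L[ℝ] ℂ) (C : ι → ι → ℂ) (i : ι)
    (h : ∀ α β, wirtinger α (wirtingerBar β (fun s => L i (Φ s))) z
      + ∑ j, ∑ k, C j k * wirtingerBar β (fun s => L j (Φ s)) z
        * wirtinger α (fun s => L k (Φ s)) z = 0) (w : EuclideanSpace ℂ (Fin m)) :
    L i (fderiv ℝ (fderiv ℝ Φ) z w w + fderiv ℝ (fderiv ℝ Φ) z (Complex.I • w) (Complex.I • w))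
      + ∑ j, ∑ k, C j k
        * (L j (fderiv ℝ Φ z w) + Complex.I * L j (fderiv ℝ Φ z (Complex.I • w)))
        * (L k (fderiv ℝ Φ z w) - Complex.I * L k (fderiv ℝ Φ z (Complex.I • w))) = 0 := by
  have hL : ∀ j, ContDiffAt ℝ 2 (fun s => L j (Φ s)) z := fun j =>
    (L j).contDiff.contDiffAt.comp z hΦ
  have h1 := sum_contract_bilinear C (fun α k => wirtinger α (fun s => L k (Φ s)) z)
    (fun β j => wirtingerBar β (fun s => L j (Φ s)) z) _ (fun α => w α) (fun α => star (w α)) h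
  simp only [sum_wirtinger_wirtingerBar (hL i), sum_star_mul_wirtingerBar, sum_mul_wirtinger,
    (fderiv_comp_clm_apply _ hΦ).1, (fderiv_comp_clm_apply _ hΦ).2] at h1
  have h2 : ∑ j, ∑ k, C j k
        * (L j (fderiv ℝ Φ z w) + Complex.I * L j (fderiv ℝ Φ z (Complex.I • w)))
        * (L k (fderiv ℝ Φ z w) - Complex.I * L k (fderiv ℝ Φ z (Complex.I • w)))
      = 4 * ∑ j, ∑ k, C j k
        * (1 / 2 * (L j (fderiv ℝ Φ z w) + Complex.I * L j (fderiv ℝ Φ z (Complex.I • w))))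
        * (1 / 2 * (L k (fderiv ℝ Φ z w) - Complex.I * L k (fderiv ℝ Φ z (Complex.I • w)))) := by
    simp only [Finset.mul_sum]
    exact Finset.sum_congr rfl fun j _ => Finset.sum_congr rfl fun k _ => by ring
  rw [h2, map_add]
  linear_combination 4 * h1

end RealForm

/-! ### Riemannian targets -/

section RiemannianTarget

set_option linter.unusedSectionVars false

variable {n : ℕ} {N : Type*} [TopologicalSpace N] [ChartedSpace (EuclideanSpace ℝ (Fin n)) N]
  [IsManifold 𝓘(ℝ, EuclideanSpace ℝ (Fin n)) ∞ N]

/-- The standard basis of Euclidean space. -/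
noncomputable def stdBasis (n : ℕ) : Module.Basis (Fin n) ℝ (EuclideanSpace ℝ (Fin n)) :=
  (EuclideanSpace.basisFun (Fin n) ℝ).toBasis

theorem coe_stdBasis (n : ℕ) : ⇑(stdBasis n) = stdFrame n := by
  ext1 i
  simp [stdBasis, stdFrame]

theorem stdBasis_repr (v : EuclideanSpace ℝ (Fin n)) (i : Fin n) : (stdBasis n).repr v i = v i := by
  simp [stdBasis]

variable {ψ : OpenPartialHomeomorph N (EuclideanSpace ℝ (Fin n))}

/-- The coordinate field is the tangent map of `ψ.symm` applied to a constant field, hence smooth as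
a section along `ψ.symm`. -/
theorem contMDiffOn_chartVec (hψ : ψ ∈ smoothCharts n N) (i : Fin n) :
    ContMDiffOn 𝓘(ℝ, EuclideanSpace ℝ (Fin n)) 𝓘(ℝ, EuclideanSpace ℝ (Fin n)).tangent ∞
      (fun y => (TotalSpace.mk' (EuclideanSpace ℝ (Fin n)) (ψ.symm y) (chartVec ψ y i) :
        TangentBundle 𝓘(ℝ, EuclideanSpace ℝ (Fin n)) N)) ψ.target := by
  have : IsManifold 𝓘(ℝ, EuclideanSpace ℝ (Fin n)) 1 N := IsManifold.of_le (n := ∞) (by simp)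
  have h1 := (contMDiffOn_symm_of_mem_maximalAtlas hψ).contMDiffOn_tangentMapWithin (m := ∞)
    (by simp) ψ.open_target.uniqueMDiffOn
  have h2 : ContMDiff 𝓘(ℝ, EuclideanSpace ℝ (Fin n)) 𝓘(ℝ, EuclideanSpace ℝ (Fin n)).tangent ∞
      (fun y => (TotalSpace.mk' (EuclideanSpace ℝ (Fin n)) y (stdFrame n i) :
        TangentBundle 𝓘(ℝ, EuclideanSpace ℝ (Fin n)) (EuclideanSpace ℝ (Fin n)))) :=
    contMDiff_vectorSpace_iff_contDiff.mpr contDiff_const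
  refine (h1.comp h2.contMDiffOn fun y hy => hy).congr fun y hy => ?_
  simp only [Function.comp, tangentMapWithin, chartVec]
  rw [mfderivWithin_of_isOpen ψ.open_target hy]

theorem contDiffOn_metricCoeff (g : SmoothRiemannianMetric n N) (hψ : ψ ∈ smoothCharts n N)
    (i j : Fin n) : ContDiffOn ℝ ∞ (fun y => metricCoeff g ψ y i j) ψ.target := by
  rw [← contMDiffOn_iff_contDiffOn]
  intro y hy
  have hb := contMDiffOn_symm_of_mem_maximalAtlas hψ y hy
  have h : ContMDiffWithinAt 𝓘(ℝ, EuclideanSpace ℝ (Fin n))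
      (𝓘(ℝ, EuclideanSpace ℝ (Fin n)).prod 𝓘(ℝ)) ∞
      (fun y => TotalSpace.mk' ℝ (E := Bundle.Trivial N ℝ) (ψ.symm y)
        (g.inner (ψ.symm y) (chartVec ψ y i) (chartVec ψ y j))) ψ.target y := by
    apply ContMDiffWithinAt.clm_bundle_apply₂ (F₁ := EuclideanSpace ℝ (Fin n))
      (F₂ := EuclideanSpace ℝ (Fin n))
    · exact ContMDiffAt.comp_contMDiffWithinAt y g.contMDiff.contMDiffAt hb
    · exact contMDiffOn_chartVec hψ i y hy
    · exact contMDiffOn_chartVec hψ j y hy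
  simp only [contMDiffWithinAt_totalSpace] at h
  exact h.2

theorem metricMap_metricCoeff (g : SmoothRiemannianMetric n N) (y v w : EuclideanSpace ℝ (Fin n)) :
    metricMap (stdBasis n) (metricCoeff g ψ) y v w
      = g.inner (ψ.symm y)
        (mfderiv 𝓘(ℝ, EuclideanSpace ℝ (Fin n)) 𝓘(ℝ, EuclideanSpace ℝ (Fin n)) ψ.symm y v)
        (mfderiv 𝓘(ℝ, EuclideanSpace ℝ (Fin n)) 𝓘(ℝ, EuclideanSpace ℝ (Fin n)) ψ.symm y w) := by
  let D : EuclideanSpace ℝ (Fin n) →L[ℝ] TangentSpace 𝓘(ℝ, EuclideanSpace ℝ (Fin n)) (ψ.symm y) :=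
    mfderiv 𝓘(ℝ, EuclideanSpace ℝ (Fin n)) 𝓘(ℝ, EuclideanSpace ℝ (Fin n)) ψ.symm y
  change _ = g.inner (ψ.symm y) (D v) (D w)
  have h : ∀ v, D v = ∑ i, v i • D (stdFrame n i) := by
    intro v
    conv_lhs => rw [← (stdBasis n).sum_repr v]
    simp only [coe_stdBasis, stdBasis_repr, map_sum, map_smul]
  rw [h v, h w, metricMap_apply]
  simp only [map_sum, map_smul, sum_apply, smul_apply, smul_eq_mul, stdBasis_repr, Finset.mul_sum]
  rw [Finset.sum_comm]
  refine Finset.sum_congr rfl fun i _ => Finset.sum_congr rfl fun j _ => ?_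
  change g.inner (ψ.symm y) (D (stdFrame n j)) (D (stdFrame n i)) * _ * _ = _
  ring

theorem representsMetric_riemannian (g : SmoothRiemannianMetric n N)
    (hK : HasNonposSectionalCurvature g) (hψ : ψ ∈ smoothCharts n N) :
    RepresentsMetric (fun y (v : EuclideanSpace ℝ (Fin n)) => g.inner y v v) ψ
      (metricMap (stdBasis n) (metricCoeff g ψ)) (christoffelMap (stdBasis n) (metricCoeff g ψ)) := by
  refine ⟨isNonposCoordMetric ψ.open_target (contDiffOn_metricCoeff g hψ) ?_ ?_ ?_, ?_⟩
  · intro y _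
    ext i j
    exact g.symm _ _ _
  · intro y hy v hv
    rw [metricMap_metricCoeff]
    refine g.pos _ _ fun h0 => hv ?_
    have hd : ψ.MDifferentiable 𝓘(ℝ, EuclideanSpace ℝ (Fin n)) 𝓘(ℝ, EuclideanSpace ℝ (Fin n)) :=
      ⟨(contMDiffOn_of_mem_maximalAtlas hψ).mdifferentiableOn (by simp),
        (contMDiffOn_symm_of_mem_maximalAtlas hψ).mdifferentiableOn (by simp)⟩
    exact hd.symm.mfderiv_injective hy (h0.trans (map_zero (mfderiv 𝓘(ℝ, EuclideanSpace ℝ (Fin n))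
      𝓘(ℝ, EuclideanSpace ℝ (Fin n)) ψ.symm y)).symm)
  · intro y hy u v huv
    rw [coe_stdBasis]
    exact hK ψ hψ y hy u v huv
  · intro y _ v
    exact (metricMap_metricCoeff g y v v).symm

theorem christoffelMap_stdBasis_apply (G : EuclideanSpace ℝ (Fin n) → Matrix (Fin n) (Fin n) ℝ)
    (y v w : EuclideanSpace ℝ (Fin n)) (i : Fin n) :
    christoffelMap (stdBasis n) G y v w i
      = ∑ j, ∑ k, christoffel (stdFrame n) G i j k y * v k * w j := by
  have hB : ∀ i i', stdBasis n i i' = if i' = i then 1 else 0 := fun i i' => by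
    simp [coe_stdBasis, stdFrame]
  simp only [christoffelMap, sum_apply, smul_apply, ContinuousLinearMap.smulRight_apply,
    coordCLM_apply, stdBasis_repr, coe_stdBasis]
  rw [Finset.sum_comm]
  simp only [← coe_stdBasis, WithLp.ofLp_sum, Finset.sum_apply, PiLp.smul_apply, hB, smul_eq_mul]
  rw [Finset.sum_comm]
  simp only [mul_ite, mul_one, mul_zero]
  rw [Finset.sum_eq_single i]
  · rw [Finset.sum_comm]
    simp [mul_assoc]
  · intro b _ hb
    simp [hb.symm]
  · simp

variable {m : ℕ} {M : Type*} [TopologicalSpace M] [ChartedSpace (EuclideanSpace ℂ (Fin m)) M]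
  [IsManifold 𝓘(ℂ, EuclideanSpace ℂ (Fin m)) ω M]

theorem IsPluriHarmonic.isPluriHarmonicAt {g : SmoothRiemannianMetric n N} {f : M → N}
    (hf : IsPluriHarmonic (m := m) g f) (x : M) :
    IsPluriHarmonicAt (m := m) (christoffelMap (stdBasis n)
      (metricCoeff g (chartAt (EuclideanSpace ℝ (Fin n)) (f x)))) f x := by
  intro z hz w
  set ψ := chartAt (EuclideanSpace ℝ (Fin n)) (f x) with hψ
  have hΦ : ContDiffAt ℝ 2 (coordMap f x : EuclideanSpace ℂ (Fin m) → EuclideanSpace ℝ (Fin n)) z :=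
    ((contDiffOn_coordMap_preferred hf.1 x).contDiffAt
      ((isOpen_preferredDomain hf.1 x).mem_nhds hz)).of_le (by norm_cast)
  ext i
  have h := real_form_of_wirtinger hΦ (fun j : Fin n => Complex.ofRealCLM.comp
      (EuclideanSpace.proj j : EuclideanSpace ℝ (Fin n) →L[ℝ] ℝ))
    (fun j k => ((christoffel (stdFrame n) (metricCoeff g ψ) i j k (coordMap f x z) : ℝ) : ℂ)) i
    (fun α β => hf.2 _ (chart_mem_holoCharts x) ψ
      (IsManifold.chart_mem_maximalAtlas (f x)) z hz.1 hz.2 i α β) w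
  -- In (a_j + i b_j)(a_k - i b_k) the cross terms are purely imaginary, and the Christoffel symbols
  -- are real. The real part leaves exactly Γ(a, a) + Γ(b, b).
  have h' := congrArg Complex.re h
  simp only [PiLp.add_apply, PiLp.zero_apply, christoffelMap_stdBasis_apply, ← Finset.sum_add_distrib]
  simp only [Complex.add_re, Complex.re_sum, ContinuousLinearMap.comp_apply, Complex.ofRealCLM_apply,
    PiLp.proj_apply, PiLp.add_apply, Complex.ofReal_re, Complex.zero_re] at h'
  rw [← h']
  congr 1
  refine Finset.sum_congr rfl fun j _ => Finset.sum_congr rfl fun k _ => ?_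
  simp
  ring

end RiemannianTarget

/-! ### Kähler targets -/

section KahlerTarget

set_option linter.unusedSectionVars false

variable {n : ℕ} {N : Type*} [TopologicalSpace N] [ChartedSpace (EuclideanSpace ℂ (Fin n)) N]
  {ψ : OpenPartialHomeomorph N (EuclideanSpace ℂ (Fin n))}

theorem top_le_span_realFrame (n : ℕ) :
    ⊤ ≤ Submodule.span ℝ (Set.range (HermitianMetric.realFrame n)) := by
  intro w _
  rw [euclidean_eq_sum w]
  refine Submodule.sum_mem _ fun α _ => Submodule.add_mem _ (Submodule.smul_mem _ _ ?_)
    (Submodule.smul_mem _ _ ?_)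
  · exact Submodule.subset_span ⟨Sum.inl α, rfl⟩
  · exact Submodule.subset_span ⟨Sum.inr α, rfl⟩

/-- The real basis of `ℂⁿ` formed by the coordinate vectors of the real coordinates. -/
noncomputable def realBasis (n : ℕ) : Module.Basis (Fin n ⊕ Fin n) ℝ (EuclideanSpace ℂ (Fin n)) :=
  basisOfTopLeSpanOfCardEqFinrank (HermitianMetric.realFrame n) (top_le_span_realFrame n)
    (by rw [finrank_real_of_complex, finrank_euclideanSpace]; simp [two_mul])

theorem coe_realBasis (n : ℕ) : ⇑(realBasis n) = HermitianMetric.realFrame n :=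
  coe_basisOfTopLeSpanOfCardEqFinrank _ _ _

namespace HermitianMetric

variable (g : HermitianMetric n N)

/-- Both sides are real bilinear, so agreement on the real coordinate frame suffices. -/
theorem metricMap_realCoeff (y v w : EuclideanSpace ℂ (Fin n)) :
    metricMap (realBasis n) (g.realCoeff ψ) y v w
      = (∑ α, ∑ β, g.coeff ψ y α β * v α * star (w β)).re := by
  set P : EuclideanSpace ℂ (Fin n) → EuclideanSpace ℂ (Fin n) → ℝ := fun v w =>
    (∑ α, ∑ β, g.coeff ψ y α β * v α * star (w β)).re with hP
  have hb : ∀ i j, g.realCoeff ψ y i j = P (realBasis n i) (realBasis n j) := by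
    intro i j
    rw [coe_realBasis]
    exact congrArg Complex.re (g.inner_holoVec y _ _)
  change _ = P v w
  rw [eq_sum_repr_mul (B := realBasis n) (f := fun v => P v w)
    (by
      intro u u'
      simp only [hP, ← Complex.add_re, ← Finset.sum_add_distrib, PiLp.add_apply]
      congr 1
      exact Finset.sum_congr rfl fun _ _ => Finset.sum_congr rfl fun _ _ => by ring)
    (by
      intro c u
      simp only [hP, ← Complex.re_ofReal_mul, Finset.mul_sum, PiLp.smul_apply, Complex.real_smul]
      congr 1
      exact Finset.sum_congr rfl fun _ _ => Finset.sum_congr rfl fun _ _ => by ring), metricMap_apply]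
  refine Finset.sum_congr rfl fun i _ => ?_
  rw [eq_sum_repr_mul (B := realBasis n) (f := fun w => P (realBasis n i) w)
    (by
      intro u u'
      simp only [hP, ← Complex.add_re, ← Finset.sum_add_distrib, PiLp.add_apply, star_add]
      congr 1
      exact Finset.sum_congr rfl fun _ _ => Finset.sum_congr rfl fun _ _ => by ring)
    (by
      intro c u
      simp only [hP, ← Complex.re_ofReal_mul, Finset.mul_sum, PiLp.smul_apply, Complex.real_smul,
        Complex.star_def, map_mul, Complex.conj_ofReal]
      congr 1
      exact Finset.sum_congr rfl fun _ _ => Finset.sum_congr rfl fun _ _ => by ring), Finset.mul_sum]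
  refine Finset.sum_congr rfl fun j _ => ?_
  rw [hb]
  ring

variable [IsManifold 𝓘(ℂ, EuclideanSpace ℂ (Fin n)) ω N] {g}

theorem contDiffOn_realCoeff (hψ : ψ ∈ holoCharts n N) (i j : Fin n ⊕ Fin n) :
    ContDiffOn ℝ ∞ (fun y => g.realCoeff ψ y i j) ψ.target := by
  have e : (fun y => g.realCoeff ψ y i j) = fun y => (∑ α, ∑ β, g.coeff ψ y α β
      * realFrame n i α * star (realFrame n j β)).re :=
    funext fun y => congrArg Complex.re (g.inner_holoVec y _ _)
  rw [e]
  exact Complex.reCLM.contDiff.comp_contDiffOn (ContDiffOn.sum fun α _ => ContDiffOn.sum fun β _ =>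
    ((g.contDiffOn_coeff hψ α β).mul contDiffOn_const).mul contDiffOn_const)

theorem representsMetric_kahler (hK : g.HasNonposSectionalCurvature) (hψ : ψ ∈ holoCharts n N) :
    RepresentsMetric (fun y (v : EuclideanSpace ℂ (Fin n)) => (g.inner y v v).re) ψ
      (metricMap (realBasis n) (g.realCoeff ψ)) (christoffelMap (realBasis n) (g.realCoeff ψ)) := by
  refine ⟨isNonposCoordMetric ψ.open_target (contDiffOn_realCoeff hψ) ?_ ?_ ?_, ?_⟩
  · intro y _
    ext i j
    change (g.inner _ _ _).re = (g.inner _ _ _).re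
    rw [← g.conj_symm]
    exact Complex.conj_re _
  · intro y hy v hv
    rw [metricMap_realCoeff]
    exact g.coeff_pos hψ hy hv
  · intro y hy u v huv
    rw [coe_realBasis]
    exact hK ψ hψ y hy u v huv
  · intro y hy v
    exact (congrArg (fun t => (g.inner (ψ.symm y) t t).re)
      ((holoVec_eq_mfderiv_real hψ hy).2 v)).trans
      ((congrArg Complex.re (g.inner_holoVec y v v)).trans (g.metricMap_realCoeff y v v).symm)

/-- The Chern connection in a holomorphic chart, as a bilinear operation. -/
noncomputable def chernMap (g : HermitianMetric n N)
    (ψ : OpenPartialHomeomorph N (EuclideanSpace ℂ (Fin n)))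
    (y v w : EuclideanSpace ℂ (Fin n)) : EuclideanSpace ℂ (Fin n) :=
  WithLp.toLp 2 fun i => ∑ j, ∑ k, g.chernChristoffel ψ i j k y * v j * w k

theorem chernChristoffel_symm (hg : g.IsKahler) (hψ : ψ ∈ holoCharts n N)
    {y : EuclideanSpace ℂ (Fin n)} (hy : y ∈ ψ.target) (i j k : Fin n) :
    g.chernChristoffel ψ i j k y = g.chernChristoffel ψ i k j y :=
  Finset.sum_congr rfl fun l _ => by rw [hg ψ hψ y hy k l j]

theorem chernMap_symm (hg : g.IsKahler) (hψ : ψ ∈ holoCharts n N)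
    {y : EuclideanSpace ℂ (Fin n)} (hy : y ∈ ψ.target) (v w : EuclideanSpace ℂ (Fin n)) :
    g.chernMap ψ y v w = g.chernMap ψ y w v := by
  ext i
  simp only [chernMap]
  rw [Finset.sum_comm]
  refine Finset.sum_congr rfl fun j _ => Finset.sum_congr rfl fun k _ => ?_
  rw [chernChristoffel_symm hg hψ hy]
  ring

theorem sum_chernChristoffel_mul_coeff (hψ : ψ ∈ holoCharts n N)
    {y : EuclideanSpace ℂ (Fin n)} (hy : y ∈ ψ.target) (j k β : Fin n) :
    ∑ i, g.chernChristoffel ψ i j k y * g.coeff ψ y i β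
      = wirtinger j (fun s => g.coeff ψ s k β) y := by
  have h1 : (g.coeff ψ y)⁻¹ * g.coeff ψ y = 1 :=
    Matrix.nonsing_inv_mul _ (isUnit_iff_ne_zero.mpr (g.det_coeff_ne_zero hψ hy))
  have h2 : ∀ l, ∑ i, g.coeffInv ψ i l y * g.coeff ψ y i β = if l = β then 1 else 0 := by
    intro l
    have := congrFun (congrFun h1 l) β
    rwa [Matrix.mul_apply, Matrix.one_apply] at this
  simp only [chernChristoffel, Finset.sum_mul]
  rw [Finset.sum_comm]
  have h3 : ∀ l, ∑ i, g.coeffInv ψ i l y * wirtinger j (fun s => g.coeff ψ s k l) y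
      * g.coeff ψ y i β = (if l = β then 1 else 0) * wirtinger j (fun s => g.coeff ψ s k l) y := by
    intro l
    rw [← h2, Finset.sum_mul]
    exact Finset.sum_congr rfl fun i _ => by ring
  simp [h3]

/-- The ∂-derivatives of h are given by the Chern Christoffel symbols by construction, and the
∂̄-derivatives follow by conjugation, as h_{αβ̄} is the conjugate of h_{βᾱ}. -/
theorem fderiv_coeff (hψ : ψ ∈ holoCharts n N)
    {y : EuclideanSpace ℂ (Fin n)} (hy : y ∈ ψ.target) (u : EuclideanSpace ℂ (Fin n))
    (α β : Fin n) :
    fderiv ℝ (fun s => g.coeff ψ s α β) y u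
      = ∑ k, u k * ∑ i, g.chernChristoffel ψ i k α y * g.coeff ψ y i β
        + ∑ k, star (u k) * ∑ i, star (g.chernChristoffel ψ i k β y) * g.coeff ψ y α i := by
  have h1 := sum_mul_wirtinger (fun s => g.coeff ψ s α β) y u
  have h2 := sum_star_mul_wirtingerBar (fun s => g.coeff ψ s α β) y u
  have h3 : ∀ k, wirtingerBar k (fun s => g.coeff ψ s α β) y
      = ∑ i, star (g.chernChristoffel ψ i k β y) * g.coeff ψ y α i := by
    intro k
    have : (fun s => g.coeff ψ s α β) = fun s => star (g.coeff ψ s β α) :=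
      funext fun s => (g.star_coeff s _ _).symm
    rw [this, ← star_wirtinger, ← sum_chernChristoffel_mul_coeff hψ hy, star_sum]
    refine Finset.sum_congr rfl fun i _ => ?_
    rw [star_mul', g.star_coeff]
  simp only [h3] at h2
  simp only [sum_chernChristoffel_mul_coeff hψ hy, h1, h2]
  ring

/-- The Chern connection preserves the real part of any Hermitian metric. The Kähler condition
enters only through torsion-freeness, in `chernMap_symm`. -/
theorem fderiv_metricMap_realCoeff (hψ : ψ ∈ holoCharts n N)
    {y : EuclideanSpace ℂ (Fin n)} (hy : y ∈ ψ.target) (u v w : EuclideanSpace ℂ (Fin n)) :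
    fderiv ℝ (metricMap (realBasis n) (g.realCoeff ψ)) y u v w
      = metricMap (realBasis n) (g.realCoeff ψ) y (g.chernMap ψ y u v) w
        + metricMap (realBasis n) (g.realCoeff ψ) y v (g.chernMap ψ y u w) := by
  have hd : DifferentiableAt ℝ (metricMap (realBasis n) (g.realCoeff ψ)) y :=
    ((contDiffOn_metricMap (contDiffOn_realCoeff hψ)).contDiffAt
      (ψ.open_target.mem_nhds hy)).differentiableAt (by simp)
  have hc : ∀ α β, DifferentiableAt ℝ (fun s => g.coeff ψ s α β) y := fun α β =>
    ((g.contDiffOn_coeff hψ α β).contDiffAt (ψ.open_target.mem_nhds hy)).differentiableAt (by simp)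
  have hs : HasFDerivAt (fun s => (∑ α, ∑ β, g.coeff ψ s α β * v α * star (w β)).re) _ y :=
    Complex.reCLM.hasFDerivAt.comp y (HasFDerivAt.fun_sum fun α _ => HasFDerivAt.fun_sum fun β _ =>
      ((hc α β).hasFDerivAt.mul_const (v α)).mul_const (star (w β)))
  rw [fderiv_metricMap_apply hd]
  simp only [metricMap_realCoeff]
  rw [hs.fderiv, ← Complex.add_re]
  simp only [ContinuousLinearMap.comp_apply, sum_apply, smul_apply, Complex.reCLM_apply,
    fderiv_coeff hψ hy, smul_eq_mul]
  congr 1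
  have e1 : ∑ α, ∑ β, g.coeff ψ y α β * g.chernMap ψ y u v α * star (w β)
      = ∑ α, ∑ β, star (w β) * (v α * ∑ k, u k * ∑ i, g.chernChristoffel ψ i k α y
        * g.coeff ψ y i β) := by
    simp only [chernMap, Finset.mul_sum, Finset.sum_mul]
    rw [Finset.sum_congr rfl fun α _ => sum_pull_out₃ _, Finset.sum_comm]
    refine Finset.sum_congr rfl fun k _ => ?_
    rw [← sum_pull_out₃]
    exact Finset.sum_congr rfl fun _ _ => Finset.sum_congr rfl fun _ _ =>
      Finset.sum_congr rfl fun _ _ => by ring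
  have e2 : ∑ α, ∑ β, g.coeff ψ y α β * v α * star (g.chernMap ψ y u w β)
      = ∑ α, ∑ β, star (w β) * (v α * ∑ k, star (u k) * ∑ i, star (g.chernChristoffel ψ i k β y)
        * g.coeff ψ y α i) := by
    simp only [chernMap, star_sum, star_mul', Finset.mul_sum]
    refine Finset.sum_congr rfl fun α _ => ?_
    rw [sum_pull_out₃]
    refine Finset.sum_congr rfl fun k _ => ?_
    rw [Finset.sum_comm]
    exact Finset.sum_congr rfl fun _ _ => Finset.sum_congr rfl fun _ _ => by ring
  rw [e1, e2]
  simp only [mul_add, Finset.sum_add_distrib]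

/-- For a Kähler metric the Chern connection is both metric and torsion-free, so uniqueness
identifies it with the Levi-Civita connection. This turns the Chern form of the equation into the
real one. -/
theorem christoffelMap_realCoeff (hg : g.IsKahler) (hK : g.HasNonposSectionalCurvature)
    (hψ : ψ ∈ holoCharts n N) {y : EuclideanSpace ℂ (Fin n)} (hy : y ∈ ψ.target)
    (v w : EuclideanSpace ℂ (Fin n)) :
    christoffelMap (realBasis n) (g.realCoeff ψ) y v w = g.chernMap ψ y v w :=
  (representsMetric_kahler hK hψ).nonpos.christoffel_unique hy _ (chernMap_symm hg hψ hy)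
    (fderiv_metricMap_realCoeff hψ hy) v w

end HermitianMetric

variable [IsManifold 𝓘(ℂ, EuclideanSpace ℂ (Fin n)) ω N]
  {m : ℕ} {M : Type*} [TopologicalSpace M] [ChartedSpace (EuclideanSpace ℂ (Fin m)) M]
  [IsManifold 𝓘(ℂ, EuclideanSpace ℂ (Fin m)) ω M]

theorem IsHermitianPluriHarmonic.isPluriHarmonicAt {g : HermitianMetric n N} {f : M → N}
    (hg : g.IsKahler) (hK : g.HasNonposSectionalCurvature)
    (hf : IsHermitianPluriHarmonic (m := m) g f) (x : M) :
    IsPluriHarmonicAt (m := m) (christoffelMap (realBasis n)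
      (g.realCoeff (chartAt (EuclideanSpace ℂ (Fin n)) (f x)))) f x := by
  have := isManifold_real (m := n) (M := N)
  intro z hz w
  set ψ := chartAt (EuclideanSpace ℂ (Fin n)) (f x)
  have hψ : ψ ∈ holoCharts n N := chart_mem_holoCharts (f x)
  have hy : (coordMap f x z : EuclideanSpace ℂ (Fin n)) ∈ ψ.target := mapsTo_coordMap f x hz
  have hΦ : ContDiffAt ℝ 2 (coordMap f x : EuclideanSpace ℂ (Fin m) → EuclideanSpace ℂ (Fin n)) z :=
    ((contDiffOn_coordMap_preferred hf.1 x).contDiffAt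
      ((isOpen_preferredDomain hf.1 x).mem_nhds hz)).of_le (by norm_cast)
  rw [HermitianMetric.christoffelMap_realCoeff hg hK hψ hy,
    HermitianMetric.christoffelMap_realCoeff hg hK hψ hy]
  ext i
  have h := real_form_of_wirtinger hΦ (fun j : Fin n =>
      (EuclideanSpace.proj j : EuclideanSpace ℂ (Fin n) →L[ℂ] ℂ).restrictScalars ℝ)
    (fun j k => g.chernChristoffel ψ i k j (coordMap f x z)) i
    (fun α β => by
      have h1 := hf.2 _ (chart_mem_holoCharts x) ψ hψ z hz.1 hz.2 i α β
      -- The Hermitian equation pairs the first lower index with ∂ and the second with ∂̄, opposite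
      -- to `real_form_of_wirtinger`; hence the interchange of `j` and `k`.
      rw [Finset.sum_comm] at h1
      rw [← h1]
      refine congrArg₂ _ rfl (Finset.sum_congr rfl fun j _ => Finset.sum_congr rfl fun k _ => ?_)
      exact mul_right_comm _ _ _) w
  generalize fderiv ℝ (coordMap f x : _ → EuclideanSpace ℂ (Fin n)) z w = a at h ⊢
  generalize fderiv ℝ (coordMap f x : _ → EuclideanSpace ℂ (Fin n)) z (Complex.I • w) = b at h ⊢
  -- Here the coordinates are complex, so the cross terms cannot be discarded by taking real parts.
  -- They are antisymmetric in `j` and `k` and vanish against the symmetric Christoffel symbols.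
  have hanti : ∑ j, ∑ k, g.chernChristoffel ψ i k j (coordMap f x z) * (b j * a k - a j * b k) = 0 := by
    simp only [mul_sub, Finset.sum_sub_distrib]
    rw [sub_eq_zero, Finset.sum_comm]
    refine Finset.sum_congr rfl fun j _ => Finset.sum_congr rfl fun k _ => ?_
    rw [HermitianMetric.chernChristoffel_symm hg hψ hy]
    ring
  have hexp : ∑ j, ∑ k, g.chernChristoffel ψ i k j (coordMap f x z) * (a j + Complex.I * b j)
        * (a k - Complex.I * b k)
      = (g.chernMap ψ (coordMap f x z) a a + g.chernMap ψ (coordMap f x z) b b) i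
        + Complex.I * ∑ j, ∑ k, g.chernChristoffel ψ i k j (coordMap f x z)
          * (b j * a k - a j * b k) := by
    simp only [PiLp.add_apply, HermitianMetric.chernMap, Finset.mul_sum,
      ← Finset.sum_add_distrib]
    refine Finset.sum_congr rfl fun j _ => Finset.sum_congr rfl fun k _ => ?_
    rw [HermitianMetric.chernChristoffel_symm hg hψ hy i k j]
    linear_combination (-(g.chernChristoffel ψ i j k (coordMap f x z)) * b j * b k) * Complex.I_sq
  rw [hanti, mul_zero, add_zero] at hexp
  exact (congrArg₂ (· + ·) rfl hexp.symm).trans h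

end KahlerTarget

/-! ### Conclusion for Riemannian and Kähler targets -/

theorem corollary1p11 {m : ℕ} {M : Type*} [TopologicalSpace M] [T2Space M] [CompactSpace M]
    [ConnectedSpace M] [ChartedSpace (EuclideanSpace ℂ (Fin m)) M]
    [IsManifold 𝓘(ℂ, EuclideanSpace ℂ (Fin m)) ω M]
    (hM : ∃ h : HermitianMetric m M, h.HasPositiveHSC) :
    (∀ {n : ℕ} {N : Type*} [TopologicalSpace N] [T2Space N]
        [ChartedSpace (EuclideanSpace ℝ (Fin n)) N]
        [IsManifold 𝓘(ℝ, EuclideanSpace ℝ (Fin n)) ∞ N]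
        (g : SmoothRiemannianMetric n N) (f : M → N),
        HasNonposSectionalCurvature g → IsPluriHarmonic (m := m) g f → ∃ c, ∀ x, f x = c) ∧
    (∀ {n : ℕ} {N : Type*} [TopologicalSpace N] [T2Space N]
        [ChartedSpace (EuclideanSpace ℂ (Fin n)) N]
        [IsManifold 𝓘(ℂ, EuclideanSpace ℂ (Fin n)) ω N]
        (g : HermitianMetric n N) (f : M → N),
        g.IsKahler → g.HasNonposSectionalCurvature → IsHermitianPluriHarmonic (m := m) g f →
          ∃ c, ∀ x, f x = c) := by
  obtain ⟨h, hpos⟩ := hM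
  refine ⟨fun {n N} _ _ _ _ g f hK hf => ?_, fun {n N} _ _ _ _ g f hg hK hf => ?_⟩
  · exact constant_of_isPluriHarmonicAt h hpos hf.1 fun x => ⟨_, _,
      representsMetric_riemannian g hK (IsManifold.chart_mem_maximalAtlas (f x)),
      hf.isPluriHarmonicAt x⟩
  · have := isManifold_real (m := n) (M := N)
    exact constant_of_isPluriHarmonicAt h hpos hf.1 fun x => ⟨_, _,
      HermitianMetric.representsMetric_kahler hK (chart_mem_holoCharts (f x)),
      hf.isPluriHarmonicAt hg hK x⟩
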